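/- Let $\mathcal H_1,\mathcal H_2$ be separable complex Hilbert spaces (inner products linear in the first variable), $\mathcal H_1\otimes\mathcal H_2$ their Hilbert space tensor product, and $U$, $V$ unitary operators on $\mathcal H_1$, $\mathcal H_2$. Let $a\in\mathcal H_1$ be such that $\{U^na\}_{n\in\mathbb Z}$ is a Riesz sequence (a Riesz basis for its closed span, i.e. the image of an orthonormal basis of that span under a boundedly invertible operator of it), and let $b\in\mathcal H_2$ and $N\ge 1$ be such that $V^Nb=b$ and $b,Vb,\dots,V^{N-1}b$ are linearly independent. Put $$\mathcal A_{a,b}=\overline{\operatorname{span}}\{U^na\otimes V^pb : n\in\mathbb Z,\ 0\le p\le N-1\}\subset\mathcal H_1\otimes\mathcal H_2 .$$ Let $r\ge 1$ be an integer, $\bar r$ a positive divisor of $N$, and $\ell=N/\bar r$. Fix $h_{11},\dots,h_{r1}\in\mathcal H_1$ and $h_{12},\dots,h_{\bar r2}\in\mathcal H_2$, and let $$\mathcal L_{jj'}x(rn,\bar rm)=\langle x,\ U^{rn}h_{j1}\otimes V^{\bar rm}h_{j'2}\rangle,\qquad x\in\mathcal A_{a,b},\ n\in\mathbb Z,\ 0\le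 m\le\ell-1,\ 1\le j\le r,\ 1\le j'\le\bar r .$$ Let $g_j(x)=\sum_{k\in\mathbb Z}\langle a,U^kh_{j1}\rangle e^{2\pi ikx}$ (a 1-periodic function whose restriction to $(0,1)$ is in $L^2(0,1)$) and assume that $g_j\in L^\infty(0,1)$ for $j=1,\dots,r$. Let $\mathbf G(x)=\big(g_j(x+\tfrac{k-1}{r})\big)_{j,k=1,\dots,r}$ and $\alpha_{\mathbf G}=\operatorname{ess\,inf}_{x\in(0,1/r)}\lambda_{\min}[\mathbf G(x)^*\mathbf G(x)]$. Let $\mathbf R_{\mathbf b,\mathbf h_2}$ be the $N\times N$ matrix (note $\bar r\ell=N$) obtained by stacking, for $j'=1,\dots,\bar r$, the $\ell\times N$ blocks with entry $\langle V^{N-\bar rm+p}b,h_{j'2}\rangle$ in row $m=0,\dots,\ell-1$ and column $p=0,\dots,N-1$. The following statements are equivalent: 1. $\alpha_{\mathbf G}>0$ and $\mathbf R_{\mathbf b,\mathbf h_2}$ is invertible. 2. There exist unique elements $c_j\otimes d_{j'}$, $1\le j\le r$, $1\le j'\le\bar r$, of $\mathcal A_{a,b}$ (unique as elements of $\mathcal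 H_1\otimes\mathcal H_2$) such that $\{(U^{rn}\otimes V^{\bar rm})(c_j\otimes d_{j'})\}_{n\in\mathbb Z,\ 0\le m\le\ell-1,\ 1\le j\le r,\ 1\le j'\le\bar r}$ is a Riesz basis for $\mathcal A_{a,b}$ and every $x\in\mathcal A_{a,b}$ has, with respect to this basis, the expansion $$x=\sum_{j=1}^r\sum_{j'=1}^{\bar r}\sum_{n\in\mathbb Z}\sum_{m=0}^{\ell-1}\mathcal L_{jj'}x(rn,\bar rm)\,(U^{rn}\otimes V^{\bar rm})(c_j\otimes d_{j'})\quad\text{in }\mathcal H_1\otimes\mathcal H_2 .$$ In case these conditions are satisfied, the vectors $c_j\otimes d_{j'}$ have the interpolation property $$\mathcal L_{kk'}(c_j\otimes d_{j'})(rn,\bar rm)=\delta_{jk}\,\delta_{j'k'}\,\delta_{n0}\,\delta_{m0}$$ for all $n\in\mathbb Z$, $0\le m\le\ell-1$, $1\le j,k\le r$ and $1\le j',k'\le\bar r$. -/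

import Mathlib

open scoped TensorProduct ENNReal

namespace TensorSampling

noncomputable section

/-! Mathlib's `inner ℂ x y` is linear in the SECOND variable, so the inner product `⟨x, y⟩` that is
linear in the first variable is written `inner ℂ y x` throughout. -/

section Basics

variable {E : Type*} [NormedAddCommGroup E] [InnerProductSpace ℂ E]

/-- `v` is a Riesz basis for the subspace `K`: it is the image of an orthonormal (Hilbert) basis
of `K` under a boundedly invertible operator of `K`. -/
def IsRieszBasisOf {ι : Type*} (K : Submodule ℂ E) (v : ι → E) : Prop :=
  ∃ (e : HilbertBasis ι ℂ K) (T : K ≃L[ℂ] K), ∀ i, v i = (T (e i) : E)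

/-- A Riesz sequence is a Riesz basis for its closed linear span. -/
def IsRieszSequence {ι : Type*} (v : ι → E) : Prop :=
  IsRieszBasisOf (Submodule.span ℂ (Set.range v)).topologicalClosure v

end Basics

section Tensor

variable (H₁ H₂ : Type*) [NormedAddCommGroup H₁] [InnerProductSpace ℂ H₁]
  [NormedAddCommGroup H₂] [InnerProductSpace ℂ H₂]

/-- The Hilbert space tensor product: the completion of the algebraic tensor product for the inner
product with `⟨u ⊗ v, u' ⊗ v'⟩ = ⟨u, u'⟩ ⟨v, v'⟩`. -/
abbrev HTensor : Type _ := UniformSpace.Completion (H₁ ⊗[ℂ] H₂)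

variable {H₁ H₂}

/-- The elementary tensor `u ⊗ v` in the Hilbert space tensor product. -/
def htmul (u : H₁) (v : H₂) : HTensor H₁ H₂ :=
  ((u ⊗ₜ[ℂ] v : H₁ ⊗[ℂ] H₂) : UniformSpace.Completion (H₁ ⊗[ℂ] H₂))

/-- The tensor product `S ⊗ T` of two bounded operators. -/
def opTensor (S : H₁ →L[ℂ] H₁) (T : H₂ →L[ℂ] H₂) : HTensor H₁ H₂ →L[ℂ] HTensor H₁ H₂ :=
  (TensorProduct.mapL S T).completion

/-- `U ^ k ⊗ V ^ q` for unitary operators `U`, `V`. -/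
def shiftOp (U : H₁ ≃ₗᵢ[ℂ] H₁) (V : H₂ ≃ₗᵢ[ℂ] H₂) (k q : ℤ) :
    HTensor H₁ H₂ →L[ℂ] HTensor H₁ H₂ :=
  opTensor ((U ^ k).toContinuousLinearEquiv : H₁ →L[ℂ] H₁)
    ((V ^ q).toContinuousLinearEquiv : H₂ →L[ℂ] H₂)

theorem inner_htmul (u u' : H₁) (v v' : H₂) :
    inner ℂ (htmul u v) (htmul u' v') = inner ℂ u u' * inner ℂ v v' := by
  simp [htmul]

theorem shiftOp_htmul (U : H₁ ≃ₗᵢ[ℂ] H₁) (V : H₂ ≃ₗᵢ[ℂ] H₂) (k q : ℤ) (u : H₁) (v : H₂) :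
    shiftOp U V k q (htmul u v) = htmul ((U ^ k) u) ((V ^ q) v) := by
  simp [shiftOp, opTensor, htmul]

/-- The closed subspace `A_{a,b}` spanned by `U ^ n a ⊗ V ^ p b`, `n ∈ ℤ`, `p = 0, …, N - 1`. -/
def invSubspace (U : H₁ ≃ₗᵢ[ℂ] H₁) (V : H₂ ≃ₗᵢ[ℂ] H₂) (a : H₁) (b : H₂) (N : ℕ) :
    Submodule ℂ (HTensor H₁ H₂) :=
  (Submodule.span ℂ
    (Set.range fun i : ℤ × Fin N => htmul ((U ^ i.1) a) ((V ^ (i.2 : ℕ)) b))).topologicalClosure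

/-- The sample `⟨x, U ^ k h₁ ⊗ V ^ q h₂⟩` of `x`; the generalized sample `L_{jj'} x (r n, r' m)` is
the one with `h₁ = h_{j1}`, `h₂ = h_{j'2}`, `k = r n`, `q = r' m`. -/
def sample (U : H₁ ≃ₗᵢ[ℂ] H₁) (V : H₂ ≃ₗᵢ[ℂ] H₂) (h₁ : H₁) (h₂ : H₂)
    (x : HTensor H₁ H₂) (k q : ℤ) : ℂ :=
  inner ℂ (htmul ((U ^ k) h₁) ((V ^ q) h₂)) x

end Tensor

section InfinitePart

variable {H₁ : Type*} [NormedAddCommGroup H₁] [InnerProductSpace ℂ H₁]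

/-- `∑ k ∈ ℤ, ⟨a, U ^ k h⟩ e^{2πikx}` as an element of `L²` of the circle `ℝ / ℤ`. When
`{U ^ n a}` is a Riesz sequence the coefficients are square summable, so the series converges. -/
def gL2 (U : H₁ ≃ₗᵢ[ℂ] H₁) (a h : H₁) :
    MeasureTheory.Lp ℂ 2 (AddCircle.haarAddCircle (T := (1 : ℝ))) :=
  ∑' k : ℤ, (inner ℂ ((U ^ k) h) a : ℂ) • fourierLp (T := (1 : ℝ)) 2 k

/-- The function `g` of the series above, as a 1-periodic function on `ℝ`. -/
def gFun (U : H₁ ≃ₗᵢ[ℂ] H₁) (a h : H₁) (x : ℝ) : ℂ :=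
  gL2 U a h (x : AddCircle (1 : ℝ))

/-- The `s × r` matrix `G(x)` with entries `g_j (x + k / r)`, `k = 0, …, r - 1`. -/
def gMatrix {s : ℕ} (U : H₁ ≃ₗᵢ[ℂ] H₁) (a : H₁) (h : Fin s → H₁) (r : ℕ) (x : ℝ) :
    Matrix (Fin s) (Fin r) ℂ :=
  Matrix.of fun j k => gFun U a (h j) (x + (k : ℝ) / (r : ℝ))

/-- The smallest eigenvalue of `A* A`, for a matrix `A` with at least one column. -/
def lambdaMin {s r : ℕ} (A : Matrix (Fin s) (Fin r) ℂ) : ℝ :=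
  ⨅ i, (Matrix.isHermitian_conjTranspose_mul_self A).eigenvalues i

/-- `α_G`: the essential infimum over `(0, 1/r)` of the smallest eigenvalue of `G(x)* G(x)`. -/
def alphaG {s : ℕ} (U : H₁ ≃ₗᵢ[ℂ] H₁) (a : H₁) (h : Fin s → H₁) (r : ℕ) : EReal :=
  essInf (fun x : ℝ => (lambdaMin (gMatrix U a h r x) : EReal))
    (MeasureTheory.volume.restrict (Set.Ioo (0 : ℝ) (1 / (r : ℝ))))

end InfinitePart

section FinitePart

variable {H₂ : Type*} [NormedAddCommGroup H₂] [InnerProductSpace ℂ H₂]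

/-- The cross-covariance `R_{b,h}(q) = ⟨V ^ q b, h⟩`. -/
def crossCov (V : H₂ ≃ₗᵢ[ℂ] H₂) (b h : H₂) (q : ℤ) : ℂ :=
  inner ℂ h ((V ^ q) b)

/-- The `s' ℓ × N` matrix `R_{b,h}` of cross-covariances, made of `s'` blocks of size `ℓ × N`
stacked on each other: row `m` of block `j'` is the row number `m + ℓ j'` and its entry in column `p`
is `R_{b,h_{j'}}(N - r' m + p)` (for `m = 0` this is `R_{b,h_{j'}}(p)` when `V ^ N b = b`). -/
def crossCovMatrix {s' : ℕ} (V : H₂ ≃ₗᵢ[ℂ] H₂) (b : H₂) (h : Fin s' → H₂) (r' ℓ N : ℕ) :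
    Matrix (Fin (s' * ℓ)) (Fin N) ℂ :=
  Matrix.of fun i p =>
    crossCov V b (h (finProdFinEquiv.symm i).1)
      ((N : ℤ) - (r' : ℤ) * (((finProdFinEquiv.symm i).2 : ℕ) : ℤ) + ((p : ℕ) : ℤ))

end FinitePart

section Expansion

variable {H₁ H₂ : Type*} [NormedAddCommGroup H₁] [InnerProductSpace ℂ H₁]
  [NormedAddCommGroup H₂] [InnerProductSpace ℂ H₂]

/-- The family `w` consists of elements `w j j' = c_j ⊗ d_{j'}` of `A_{a,b}` such that the shifts
`(U ^ (r n) ⊗ V ^ (r' m)) (c_j ⊗ d_{j'})`, `n ∈ ℤ`, `m = 0, …, ℓ - 1`, form a Riesz basis for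
`A_{a,b}`, and the expansion of any `x` in `A_{a,b}` with respect to this basis has the samples of
`x` as its coefficients. -/
structure IsSamplingRieszBasis (U : H₁ ≃ₗᵢ[ℂ] H₁) (V : H₂ ≃ₗᵢ[ℂ] H₂) (a : H₁) (b : H₂)
    (N r r' ℓ : ℕ) {s s' : ℕ} (h₁ : Fin s → H₁) (h₂ : Fin s' → H₂)
    (w : Fin s → Fin s' → HTensor H₁ H₂) : Prop where
  exists_eq_tmul : ∃ (c : Fin s → H₁) (d : Fin s' → H₂), ∀ j j', w j j' = htmul (c j) (d j')
  mem : ∀ j j', w j j' ∈ invSubspace U V a b N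
  rieszBasis : IsRieszBasisOf (invSubspace U V a b N)
    fun i : Fin s × Fin s' × ℤ × Fin ℓ =>
      shiftOp U V ((r : ℤ) * i.2.2.1) ((r' : ℤ) * ((i.2.2.2 : ℕ) : ℤ)) (w i.1 i.2.1)
  expansion : ∀ x ∈ invSubspace U V a b N,
    HasSum (fun i : Fin s × Fin s' × ℤ × Fin ℓ =>
      sample U V (h₁ i.1) (h₂ i.2.1) x ((r : ℤ) * i.2.2.1) ((r' : ℤ) * ((i.2.2.2 : ℕ) : ℤ)) •
        shiftOp U V ((r : ℤ) * i.2.2.1) ((r' : ℤ) * ((i.2.2.2 : ℕ) : ℤ)) (w i.1 i.2.1)) x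

end Expansion

end

end TensorSampling

/-! Let `K` be the closed span of the `U ^ n a`. The space `A_{a,b}` is the tensor product of `K`
and the cyclic span of `b` (`invSubspace_eq_tensorSubspace`), tensor products of Riesz bases are
Riesz bases (`IsRieszBasisOf.htmul`), and samples of elementary tensors factor. Sufficiency
therefore splits into two one-factor problems: find vectors whose shifts form a Riesz basis
biorthogonal to the sampling vectors.

In the finite factor this is linear algebra: `crossCovMatrix` is the matrix of the sampling map in
the basis `V ^ p b` (`crossCovMatrix_mulVec`). In the infinite factor, `K` is identified with `L²`
of the circle by `Φ`, sending the character of frequency `n` to `U ^ n a`; sampling against `U ^ k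
h` becomes the `k`-th Fourier coefficient of `g F` (`inner_zpow_eq_fourierCoeff`). Keeping only the
frequencies in `r ℤ` amounts to averaging over the translates by `k / r`, so the sample energy is
the integral of `‖G(y) X(y)‖²`, up to the factor `r⁻²`, with `X(y)` the vector of the `F(y + k / r)`
(`hasSum_sq_fourierCoeff_symbol`). A lower bound on the square matrix `G` gives the frame bound, and
injectivity of `G*` gives dense range (`eq_zero_of_hasSum_symbol`). Sampling is then an isomorphism
of `K` onto `ℓ²` (`exists_analysis_equiv`), and the dual vectors are preimages of unit sequences.

For necessity, the Riesz bound controls `‖Φ F ⊗ v‖` by the product of the two sample energies.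
Freezing `v = b` gives an integral lower bound for the symbols, made pointwise by cutting off to the
set where it fails (`ae_lower_bound`). Freezing a nonzero `F` shows that the finite sampling map is
injective. Uniqueness and interpolation come from uniqueness of coefficients in a Riesz basis. -/

namespace TensorSampling

/-! ### Riesz bases as isomorphic images of the standard basis of `ℓ²`. -/

section RieszBasis

variable {E ι κ : Type*} [NormedAddCommGroup E] [InnerProductSpace ℂ E]

/-- A Riesz basis is the image of the standard basis of `ℓ²` under a bounded isomorphism. -/
theorem IsRieszBasisOf.exists_equiv [DecidableEq ι] {K : Submodule ℂ E} {v : ι → E}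
    (h : IsRieszBasisOf K v) :
    ∃ L : lp (fun _ : ι => ℂ) 2 ≃L[ℂ] K, ∀ i, v i = (L (lp.single 2 i 1) : E) := by
  obtain ⟨e, T, hT⟩ := h
  refine ⟨e.repr.symm.toContinuousLinearEquiv.trans T, fun i => ?_⟩
  rw [hT i]
  simp

/-- The Hilbert basis `e` may be arbitrary: it only identifies `K` with `ℓ²`, so that `L` becomes an
automorphism of `K`. -/
theorem isRieszBasisOf_of_equiv [DecidableEq ι] {K : Submodule ℂ E} {v : ι → E}
    (e : HilbertBasis ι ℂ K) (L : lp (fun _ : ι => ℂ) 2 ≃L[ℂ] K)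
    (hL : ∀ i, v i = (L (lp.single 2 i 1) : E)) : IsRieszBasisOf K v :=
  ⟨e, e.repr.toContinuousLinearEquiv.trans L, fun i => by simp [hL, e.repr_self]⟩

theorem hasSum_smul_of_equiv [DecidableEq ι] {K : Submodule ℂ E} {v : ι → E}
    (L : lp (fun _ : ι => ℂ) 2 ≃L[ℂ] K) (hL : ∀ i, v i = (L (lp.single 2 i 1) : E))
    (f : lp (fun _ : ι => ℂ) 2) : HasSum (fun i => f i • v i) (L f : E) := by
  have h := (lp.hasSum_single (p := 2) (by norm_num) f).mapL
    (K.subtypeL.comp (L : lp (fun _ : ι => ℂ) 2 →L[ℂ] K))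
  convert h using 1
  · funext i
    have : lp.single (E := fun _ : ι => ℂ) 2 i (f i) = f i • lp.single (E := fun _ : ι => ℂ) 2 i 1 := by
      rw [← lp.single_smul]; simp
    rw [this, map_smul, hL]
    rfl
  · rfl

/-- The coefficients of an expansion in a Riesz basis are determined by its sum. -/
theorem coeff_eq_of_equiv [DecidableEq ι] {K : Submodule ℂ E} {v : ι → E}
    (L : lp (fun _ : ι => ℂ) 2 ≃L[ℂ] K) (hL : ∀ i, v i = (L (lp.single 2 i 1) : E))
    {c : ι → ℂ} {x : K} (hc : HasSum (fun i => c i • v i) (x : E)) (i : ι) :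
    L.symm x i = c i := by
  have hK : HasSum (fun i => c i • L (lp.single 2 i 1)) x := by
    have hi : Topology.IsInducing K.subtype := Topology.IsInducing.subtypeVal
    rw [← hi.hasSum_iff]
    exact hc.congr_fun fun i => by simp [hL]
  have h2 := (hK.mapL (L.symm : K →L[ℂ] lp (fun _ : ι => ℂ) 2)).mapL
    (lp.evalCLM ℂ (fun _ : ι => ℂ) 2 i)
  refine h2.unique ?_
  refine (hasSum_ite_eq i (c i)).congr_fun fun k => ?_
  have hev : ∀ g : lp (fun _ : ι => ℂ) 2, lp.evalCLM ℂ (fun _ : ι => ℂ) 2 i g = g i :=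
    fun _ => rfl
  by_cases hk : k = i
  · subst hk; simp [hev]
  · simp [hk, hev, Ne.symm hk]

theorem mem_of_isRieszBasisOf {K : Submodule ℂ E} {v : ι → E} (h : IsRieszBasisOf K v) (i : ι) :
    v i ∈ K := by
  obtain ⟨e, T, hT⟩ := h
  simp [hT]

/-- An expansion holds as soon as its coefficient functionals are biorthogonal to the Riesz basis. -/
theorem IsRieszBasisOf.hasSum_of_biorthogonal [DecidableEq ι] {K : Submodule ℂ E} {v w : ι → E}
    (h : IsRieszBasisOf K v) (hw : ∀ i k, inner ℂ (w i) (v k) = if k = i then (1 : ℂ) else 0)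
    {x : E} (hx : x ∈ K) : HasSum (fun i => inner ℂ (w i) x • v i) x := by
  obtain ⟨L, hL⟩ := h.exists_equiv
  have h1 := hasSum_smul_of_equiv L hL (L.symm ⟨x, hx⟩)
  rw [L.apply_symm_apply] at h1
  convert h1 using 3 with i
  refine (h1.mapL (innerSL ℂ (w i))).unique ?_
  refine (hasSum_ite_eq i (L.symm ⟨x, hx⟩ i)).congr_fun fun k => ?_
  by_cases hk : k = i
  · subst hk; simp [hw]
  · simp [hw, hk]

/-- Lower frame bound for the coefficients of an expansion in a Riesz basis. -/
theorem IsRieszBasisOf.exists_norm_sq_le {K : Submodule ℂ E} {v : ι → E}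
    (h : IsRieszBasisOf K v) : ∃ C : ℝ, 0 < C ∧ ∀ x ∈ K, ∀ c : ι → ℂ,
      HasSum (fun i => c i • v i) x →
        Summable (fun i => ‖c i‖ ^ 2) ∧ ‖x‖ ^ 2 ≤ C * ∑' i, ‖c i‖ ^ 2 := by
  classical
  obtain ⟨L, hL⟩ := h.exists_equiv
  -- The `+ 1` keeps the constant positive even when `K` is trivial and `L` vanishes.
  refine ⟨‖(L : lp (fun _ : ι => ℂ) 2 →L[ℂ] K)‖ ^ 2 + 1, by positivity, fun x hx c hc => ?_⟩
  set f := L.symm ⟨x, hx⟩ with hf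
  have hfc : ∀ i, f i = c i := coeff_eq_of_equiv L hL (x := ⟨x, hx⟩) hc
  have hs : HasSum (fun i => ‖f i‖ ^ 2) (‖f‖ ^ 2) := by
    have := lp.hasSum_norm (p := 2) (by norm_num) f
    simpa using this
  simp only [hfc] at hs
  refine ⟨hs.summable, ?_⟩
  rw [hs.tsum_eq]
  have h1 : ‖x‖ ≤ ‖(L : lp (fun _ : ι => ℂ) 2 →L[ℂ] K)‖ * ‖f‖ := by
    have := (L : lp (fun _ : ι => ℂ) 2 →L[ℂ] K).le_opNorm f
    simpa [hf] using this
  calc ‖x‖ ^ 2 ≤ (‖(L : lp (fun _ : ι => ℂ) 2 →L[ℂ] K)‖ * ‖f‖) ^ 2 := by gcongr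
    _ ≤ _ := by rw [mul_pow]; gcongr; linarith

/-- Transport of a Hilbert basis along a bijection of the index types. -/
noncomputable def reindexHilbertBasis [CompleteSpace E] (e : HilbertBasis ι ℂ E) (σ : ι ≃ κ) :
    HilbertBasis κ ℂ E :=
  HilbertBasis.mk (v := fun k => e (σ.symm k)) (e.orthonormal.comp _ σ.symm.injective) (by
    have : Set.range (fun k => e (σ.symm k)) = Set.range e := σ.symm.surjective.range_comp e
    rw [this, e.dense_span])

@[simp] theorem reindexHilbertBasis_apply [CompleteSpace E] (e : HilbertBasis ι ℂ E) (σ : ι ≃ κ)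
    (k : κ) : reindexHilbertBasis e σ k = e (σ.symm k) := by
  simp [reindexHilbertBasis]

theorem IsRieszBasisOf.reindex {K : Submodule ℂ E} [CompleteSpace K] {v : ι → E}
    (h : IsRieszBasisOf K v) (σ : ι ≃ κ) : IsRieszBasisOf K fun k => v (σ.symm k) := by
  obtain ⟨e, T, hT⟩ := h
  exact ⟨reindexHilbertBasis e σ, T, fun k => by simp [hT]⟩

/-- A basis of a finite-dimensional subspace is a Riesz basis. -/
theorem isRieszBasisOf_of_basis [Fintype ι] {K : Submodule ℂ E} (B : Module.Basis ι ℂ K) :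
    IsRieszBasisOf K fun i => (B i : E) := by
  have : FiniteDimensional ℂ K := B.finiteDimensional_of_finite
  let o : OrthonormalBasis ι ℂ K := (stdOrthonormalBasis ℂ K).reindex
    ((finCongr (Module.finrank_eq_card_basis B)).trans (Fintype.equivFin ι).symm)
  refine ⟨o.toHilbertBasis, (o.toBasis.equiv B (Equiv.refl ι)).toContinuousLinearEquiv, fun i => ?_⟩
  have : o i = o.toBasis i := by simp
  simp only [OrthonormalBasis.coe_toHilbertBasis, this, LinearEquiv.coe_toContinuousLinearEquiv']
  simp only [Module.Basis.equiv_apply]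
  rfl

/-- The analysis operator of a family with two-sided frame bounds and no relations is an
isomorphism onto `ℓ²`. -/
theorem exists_analysis_equiv {H : Type*} [NormedAddCommGroup H] [InnerProductSpace ℂ H]
    [CompleteSpace H] (ψ : ι → H) {A B : ℝ} (hA : 0 < A)
    (hs : ∀ x, Summable fun i => ‖inner ℂ (ψ i) x‖ ^ 2)
    (hlow : ∀ x, A * ‖x‖ ^ 2 ≤ ∑' i, ‖inner ℂ (ψ i) x‖ ^ 2)
    (hup : ∀ x, ∑' i, ‖inner ℂ (ψ i) x‖ ^ 2 ≤ B * ‖x‖ ^ 2)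
    (hdense : ∀ y : lp (fun _ : ι => ℂ) 2,
      (∀ x, HasSum (fun i => inner ℂ (ψ i) x * (starRingEnd ℂ) (y i)) 0) → y = 0) :
    ∃ L : H ≃L[ℂ] lp (fun _ : ι => ℂ) 2, ∀ x i, L x i = inner ℂ (ψ i) x := by
  have hmem : ∀ x, Memℓp (fun i => (inner ℂ (ψ i) x : ℂ)) 2 := fun x =>
    memℓp_gen (by simpa using hs x)
  let S : H →ₗ[ℂ] lp (fun _ : ι => ℂ) 2 :=
    { toFun := fun x => ⟨fun i => inner ℂ (ψ i) x, hmem x⟩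
      map_add' := fun x y => by ext i; exact inner_add_right _ _ _
      map_smul' := fun c x => by ext i; exact inner_smul_right _ _ _ }
  have hSi : ∀ x i, S x i = inner ℂ (ψ i) x := fun x i => rfl
  have hSn : ∀ x, ‖S x‖ ^ 2 = ∑' i, ‖inner ℂ (ψ i) x‖ ^ 2 := fun x => by
    have := (lp.hasSum_norm (p := 2) (by norm_num) (S x)).tsum_eq
    simpa [hSi] using this.symm
  -- No sign of `B` is assumed, hence the `max B 0` under the root.
  have hB : ∀ x, ‖S x‖ ≤ √(max B 0) * ‖x‖ := fun x => by
    rw [← Real.sqrt_sq (norm_nonneg x), ← Real.sqrt_mul (le_max_right _ _)]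
    refine Real.le_sqrt_of_sq_le ?_
    rw [hSn]
    exact (hup x).trans (by gcongr; exact le_max_left _ _)
  let T : H →L[ℂ] lp (fun _ : ι => ℂ) 2 := S.mkContinuous _ hB
  have hT : ∀ x, T x = S x := fun x => rfl
  -- The lower frame bound makes the range closed; `hdense` then kills its orthogonal complement.
  have hanti : AntilipschitzWith (Real.toNNReal (√A)⁻¹) T := by
    refine T.antilipschitz_of_bound fun x => ?_
    rw [Real.coe_toNNReal _ (by positivity), inv_mul_eq_div, le_div_iff₀ (by positivity)]
    refine le_of_sq_le_sq ?_ (norm_nonneg _)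
    rw [mul_pow, Real.sq_sqrt hA.le, hT, hSn, mul_comm]
    exact hlow x
  have hclosed : IsClosed (T.range : Set (lp (fun _ : ι => ℂ) 2)) := by
    exact hanti.isClosed_range T.uniformContinuous
  have hsurj : T.range = ⊤ := by
    have : CompleteSpace T.range := hclosed.completeSpace_coe
    rw [← Submodule.orthogonal_eq_bot_iff, Submodule.eq_bot_iff]
    intro y hy
    refine hdense y fun x => ?_
    have h0 : inner ℂ y (T x) = 0 := (Submodule.mem_orthogonal' _ _).1 hy _ ⟨x, rfl⟩
    have := lp.hasSum_inner (𝕜 := ℂ) y (T x)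
    rw [h0] at this
    simp only [RCLike.inner_apply] at this
    exact this
  exact ⟨ContinuousLinearEquiv.ofBijective T
    (LinearMap.ker_eq_bot.2 hanti.injective) hsurj, fun x i => rfl⟩

end RieszBasis

/-! ### Tensor products of subspaces, Hilbert bases and Riesz bases. -/

section TensorRiesz

variable {H₁ H₂ ι κ : Type*} [NormedAddCommGroup H₁] [InnerProductSpace ℂ H₁]
  [NormedAddCommGroup H₂] [InnerProductSpace ℂ H₂]

/-- The elementary tensor as a continuous bilinear map. -/
noncomputable def htmulL : H₁ →L[ℂ] H₂ →L[ℂ] HTensor H₁ H₂ :=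
  (ContinuousLinearMap.compL ℂ H₂ _ _ UniformSpace.Completion.toComplL).comp
    (TensorProduct.mkL ℂ H₁ H₂)

@[simp] theorem opTensor_htmul (S : H₁ →L[ℂ] H₁) (T : H₂ →L[ℂ] H₂) (u : H₁) (v : H₂) :
    opTensor S T (htmul u v) = htmul (S u) (T v) := by
  simp [opTensor, htmul]

theorem norm_htmul (u : H₁) (v : H₂) : ‖htmul u v‖ = ‖u‖ * ‖v‖ := by
  simp [htmul]

/-- The closed span of the elementary tensors of two subspaces. -/
noncomputable def tensorSubspace (K₁ : Submodule ℂ H₁) (K₂ : Submodule ℂ H₂) :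
    Submodule ℂ (HTensor H₁ H₂) :=
  (Submodule.span ℂ (Set.range fun i : K₁ × K₂ => htmul (i.1 : H₁) (i.2 : H₂))).topologicalClosure

theorem htmul_mem_tensorSubspace {K₁ : Submodule ℂ H₁} {K₂ : Submodule ℂ H₂} {u : H₁} {v : H₂}
    (hu : u ∈ K₁) (hv : v ∈ K₂) : htmul u v ∈ tensorSubspace K₁ K₂ :=
  Submodule.le_topologicalClosure _ (Submodule.subset_span ⟨(⟨u, hu⟩, ⟨v, hv⟩), rfl⟩)

theorem tensorSubspace_le {K₁ : Submodule ℂ H₁} {K₂ : Submodule ℂ H₂}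
    {C : Submodule ℂ (HTensor H₁ H₂)} (hC : IsClosed (C : Set (HTensor H₁ H₂)))
    (h : ∀ u ∈ K₁, ∀ v ∈ K₂, htmul u v ∈ C) : tensorSubspace K₁ K₂ ≤ C := by
  refine Submodule.topologicalClosure_minimal _ (Submodule.span_le.2 ?_) hC
  rintro _ ⟨⟨u, v⟩, rfl⟩
  exact h u u.2 v v.2

/-- The elementary tensor is linear and continuous in each variable, so the closures are handled one
factor at a time: first `u` against each generator `t j`, then `v` against the fixed `u`. -/
theorem htmul_mem_closure_span (s : ι → H₁) (t : κ → H₂) {u : H₁} {v : H₂}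
    (hu : u ∈ (Submodule.span ℂ (Set.range s)).topologicalClosure)
    (hv : v ∈ (Submodule.span ℂ (Set.range t)).topologicalClosure) :
    htmul u v ∈ (Submodule.span ℂ
      (Set.range fun i : ι × κ => htmul (s i.1) (t i.2))).topologicalClosure := by
  set C := (Submodule.span ℂ
      (Set.range fun i : ι × κ => htmul (s i.1) (t i.2))).topologicalClosure with hCdef
  have hC : IsClosed (C : Set (HTensor H₁ H₂)) := Submodule.isClosed_topologicalClosure _
  have h1 : ∀ j, htmul u (t j) ∈ C := fun j => by
    have : (Submodule.span ℂ (Set.range s)).topologicalClosure ≤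
        C.comap ((htmulL (H₁ := H₁) (H₂ := H₂)).flip (t j)).toLinearMap := by
      refine Submodule.topologicalClosure_minimal _ (Submodule.span_le.2 ?_)
        (hC.preimage ((htmulL (H₁ := H₁) (H₂ := H₂)).flip (t j)).continuous)
      rintro _ ⟨i, rfl⟩
      exact Submodule.le_topologicalClosure _ (Submodule.subset_span ⟨(i, j), rfl⟩)
    exact this hu
  have : (Submodule.span ℂ (Set.range t)).topologicalClosure ≤
      C.comap (htmulL (H₁ := H₁) (H₂ := H₂) u).toLinearMap := by
    refine Submodule.topologicalClosure_minimal _ (Submodule.span_le.2 ?_)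
      (hC.preimage (htmulL (H₁ := H₁) (H₂ := H₂) u).continuous)
    rintro _ ⟨j, rfl⟩
    exact h1 j
  exact this hv

theorem tensorSubspace_closure_span (s : ι → H₁) (t : κ → H₂) :
    tensorSubspace (Submodule.span ℂ (Set.range s)).topologicalClosure
        (Submodule.span ℂ (Set.range t)).topologicalClosure =
      (Submodule.span ℂ
        (Set.range fun i : ι × κ => htmul (s i.1) (t i.2))).topologicalClosure := by
  refine le_antisymm (tensorSubspace_le (Submodule.isClosed_topologicalClosure _)
    fun u hu v hv => htmul_mem_closure_span s t hu hv) ?_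
  refine Submodule.topologicalClosure_mono (Submodule.span_mono ?_)
  rintro _ ⟨⟨i, j⟩, rfl⟩
  exact ⟨(⟨s i, Submodule.le_topologicalClosure _ (Submodule.subset_span ⟨i, rfl⟩)⟩,
    ⟨t j, Submodule.le_topologicalClosure _ (Submodule.subset_span ⟨j, rfl⟩)⟩), rfl⟩

theorem hilbertBasis_closure_span_coe {E : Type*} [NormedAddCommGroup E] [InnerProductSpace ℂ E]
    {K : Submodule ℂ E} [CompleteSpace K] (e : HilbertBasis ι ℂ K) :
    (Submodule.span ℂ (Set.range fun i => (e i : E))).topologicalClosure = K := by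
  have hK : IsClosed (K : Set E) := (completeSpace_coe_iff_isComplete.1 ‹_›).isClosed
  refine le_antisymm (Submodule.topologicalClosure_minimal _ (Submodule.span_le.2 ?_) hK) ?_
  · rintro _ ⟨i, rfl⟩
    exact (e i).2
  · intro x hx
    have h : (⟨x, hx⟩ : K) ∈ (Submodule.span ℂ (Set.range e)).topologicalClosure := by
      rw [e.dense_span]; trivial
    have h2 := map_mem_closure K.subtypeL.continuous h
      (t := (Submodule.span ℂ (Set.range fun i => (e i : E)) : Set E)) (fun y hy => by
        have : Submodule.span ℂ (Set.range e) ≤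
            (Submodule.span ℂ (Set.range fun i => (e i : E))).comap K.subtype := by
          rw [Submodule.span_le]
          rintro _ ⟨i, rfl⟩
          exact Submodule.subset_span ⟨i, rfl⟩
        exact this hy)
    exact h2

/-- The tensor products of two Hilbert bases form a Hilbert basis. -/
theorem exists_hilbertBasis_htmul {K₁ : Submodule ℂ H₁} {K₂ : Submodule ℂ H₂}
    [CompleteSpace K₁] [CompleteSpace K₂] (e : HilbertBasis ι ℂ K₁) (f : HilbertBasis κ ℂ K₂) :
    ∃ g : HilbertBasis (ι × κ) ℂ (tensorSubspace K₁ K₂),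
      ∀ i, (g i : HTensor H₁ H₂) = htmul (e i.1 : H₁) (f i.2 : H₂) := by
  classical
  have hspan : tensorSubspace K₁ K₂ = (Submodule.span ℂ
      (Set.range fun i : ι × κ => htmul (e i.1 : H₁) (f i.2 : H₂))).topologicalClosure := by
    rw [← tensorSubspace_closure_span (fun i => (e i : H₁)) (fun j => (f j : H₂)),
      hilbertBasis_closure_span_coe, hilbertBasis_closure_span_coe]
  have hclosed : IsClosed (tensorSubspace K₁ K₂ : Set (HTensor H₁ H₂)) :=
    Submodule.isClosed_topologicalClosure _
  have : CompleteSpace (tensorSubspace K₁ K₂) := hclosed.completeSpace_coe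
  let v : ι × κ → tensorSubspace K₁ K₂ := fun i =>
    ⟨htmul (e i.1 : H₁) (f i.2 : H₂), htmul_mem_tensorSubspace (e i.1).2 (f i.2).2⟩
  have hv : Orthonormal ℂ v := by
    rw [orthonormal_iff_ite]
    rintro ⟨i, j⟩ ⟨i', j'⟩
    have h1 := (orthonormal_iff_ite.1 e.orthonormal) i i'
    have h2 := (orthonormal_iff_ite.1 f.orthonormal) j j'
    rw [Submodule.coe_inner] at h1 h2 ⊢
    simp only [v]
    rw [inner_htmul, h1, h2]
    by_cases hi : i = i' <;> by_cases hj : j = j' <;> simp [hi, hj]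
  suffices hbot : (Submodule.span ℂ (Set.range v))ᗮ = ⊥ from
    ⟨HilbertBasis.mkOfOrthogonalEqBot hv hbot, fun i => by
      rw [HilbertBasis.coe_mkOfOrthogonalEqBot]⟩
  rw [Submodule.eq_bot_iff]
  intro x hx
  rw [Submodule.mem_orthogonal'] at hx
  -- The vectors orthogonal to `x` form a closed subspace containing every product of basis vectors,
  -- hence the whole tensor subspace and `x` itself.
  have hle : tensorSubspace K₁ K₂ ≤ LinearMap.ker (innerSL ℂ (x : HTensor H₁ H₂)).toLinearMap := by
    refine hspan.le.trans ?_
    refine Submodule.topologicalClosure_minimal _ (Submodule.span_le.2 ?_)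
      (innerSL ℂ (x : HTensor H₁ H₂)).isClosed_ker
    rintro _ ⟨i, rfl⟩
    exact hx (v i) (Submodule.subset_span ⟨i, rfl⟩)
  have : inner ℂ (x : HTensor H₁ H₂) x = 0 := hle x.2
  simpa using this

/-- Two bounded operators agreeing on elementary tensors agree on their closed span. -/
theorem eqOn_tensorSubspace {K₁ : Submodule ℂ H₁} {K₂ : Submodule ℂ H₂}
    (S T : HTensor H₁ H₂ →L[ℂ] HTensor H₁ H₂)
    (h : ∀ u ∈ K₁, ∀ v ∈ K₂, S (htmul u v) = T (htmul u v)) {x : HTensor H₁ H₂}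
    (hx : x ∈ tensorSubspace K₁ K₂) : S x = T x := by
  have : tensorSubspace K₁ K₂ ≤ LinearMap.ker (S - T).toLinearMap :=
    tensorSubspace_le (S - T).isClosed_ker fun u hu v hv => by simp [h u hu v hv]
  have h2 : (S - T) x = 0 := this hx
  exact sub_eq_zero.1 (by simpa using h2)

/-- An operator of a complete subspace, extended by zero to the orthogonal complement. -/
noncomputable def extendOp {E : Type*} [NormedAddCommGroup E] [InnerProductSpace ℂ E]
    {K : Submodule ℂ E} [CompleteSpace K] (T : K →L[ℂ] K) : E →L[ℂ] E :=
  K.subtypeL.comp (T.comp K.orthogonalProjectionOnto)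

theorem extendOp_apply {E : Type*} [NormedAddCommGroup E] [InnerProductSpace ℂ E]
    {K : Submodule ℂ E} [CompleteSpace K] (T : K →L[ℂ] K) (x : K) :
    extendOp T (x : E) = T x := by
  simp [extendOp]

theorem extendOp_mem {E : Type*} [NormedAddCommGroup E] [InnerProductSpace ℂ E]
    {K : Submodule ℂ E} [CompleteSpace K] (T : K →L[ℂ] K) (x : E) : extendOp T x ∈ K := by
  simp [extendOp]

theorem opTensor_extendOp_mem {K₁ : Submodule ℂ H₁} {K₂ : Submodule ℂ H₂}
    [CompleteSpace K₁] [CompleteSpace K₂] (S : K₁ →L[ℂ] K₁) (T : K₂ →L[ℂ] K₂)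
    {x : HTensor H₁ H₂} (hx : x ∈ tensorSubspace K₁ K₂) :
    opTensor (extendOp S) (extendOp T) x ∈ tensorSubspace K₁ K₂ := by
  have : tensorSubspace K₁ K₂ ≤
      (tensorSubspace K₁ K₂).comap (opTensor (extendOp S) (extendOp T)).toLinearMap :=
    tensorSubspace_le ((Submodule.isClosed_topologicalClosure _).preimage
      (opTensor (extendOp S) (extendOp T)).continuous) fun u _ v _ => by
        simpa using htmul_mem_tensorSubspace (extendOp_mem S u) (extendOp_mem T v)
  exact this hx

/-- On elementary tensors from `K₁` and `K₂` the extensions act as `S`, `T` and their inverses.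
Extension by zero is not invertible on the whole space in general, so the identity is confined to
the tensor subspace. -/
theorem opTensor_extendOp_symm {K₁ : Submodule ℂ H₁} {K₂ : Submodule ℂ H₂}
    [CompleteSpace K₁] [CompleteSpace K₂] (S : K₁ ≃L[ℂ] K₁) (T : K₂ ≃L[ℂ] K₂)
    {x : HTensor H₁ H₂} (hx : x ∈ tensorSubspace K₁ K₂) :
    opTensor (extendOp (S.symm : K₁ →L[ℂ] K₁)) (extendOp (T.symm : K₂ →L[ℂ] K₂))
      (opTensor (extendOp (S : K₁ →L[ℂ] K₁)) (extendOp (T : K₂ →L[ℂ] K₂)) x) = x := by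
  refine eqOn_tensorSubspace (((opTensor (extendOp (S.symm : K₁ →L[ℂ] K₁))
    (extendOp (T.symm : K₂ →L[ℂ] K₂)))).comp
      (opTensor (extendOp (S : K₁ →L[ℂ] K₁)) (extendOp (T : K₂ →L[ℂ] K₂))))
    (ContinuousLinearMap.id ℂ _) (fun u hu v hv => ?_) hx
  have h1 := extendOp_apply (S : K₁ →L[ℂ] K₁) ⟨u, hu⟩
  have h2 := extendOp_apply (T : K₂ →L[ℂ] K₂) ⟨v, hv⟩
  simp only [ContinuousLinearMap.comp_apply, opTensor_htmul, ContinuousLinearMap.id_apply]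
  rw [h1, h2, extendOp_apply, extendOp_apply]
  simp

/-- The tensor products of two Riesz bases form a Riesz basis. -/
theorem IsRieszBasisOf.htmul {K₁ : Submodule ℂ H₁} {K₂ : Submodule ℂ H₂}
    [CompleteSpace K₁] [CompleteSpace K₂] {v₁ : ι → H₁} {v₂ : κ → H₂}
    (h₁ : IsRieszBasisOf K₁ v₁) (h₂ : IsRieszBasisOf K₂ v₂) :
    IsRieszBasisOf (tensorSubspace K₁ K₂) fun i : ι × κ => htmul (v₁ i.1) (v₂ i.2) := by
  obtain ⟨e, S, hS⟩ := h₁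
  obtain ⟨f, T, hT⟩ := h₂
  obtain ⟨g, hg⟩ := exists_hilbertBasis_htmul e f
  let M := opTensor (extendOp (S : K₁ →L[ℂ] K₁)) (extendOp (T : K₂ →L[ℂ] K₂))
  let M' := opTensor (extendOp (S.symm : K₁ →L[ℂ] K₁)) (extendOp (T.symm : K₂ →L[ℂ] K₂))
  let R : tensorSubspace K₁ K₂ ≃L[ℂ] tensorSubspace K₁ K₂ :=
    ContinuousLinearEquiv.equivOfInverse
      ((M.comp (Submodule.subtypeL _)).codRestrict _ fun x => opTensor_extendOp_mem _ _ x.2)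
      ((M'.comp (Submodule.subtypeL _)).codRestrict _ fun x => opTensor_extendOp_mem _ _ x.2)
      (fun x => Subtype.ext (opTensor_extendOp_symm S T x.2))
      (fun x => Subtype.ext (opTensor_extendOp_symm S.symm T.symm x.2))
  refine ⟨g, R, fun i => ?_⟩
  have : (R (g i) : HTensor H₁ H₂) = M (g i) := rfl
  rw [this, hg, opTensor_htmul, extendOp_apply, extendOp_apply]
  simp only [hS, hT]
  rfl

end TensorRiesz

/-! ### Integer powers of a unitary operator. -/

section Shift

variable {H : Type*} [NormedAddCommGroup H] [InnerProductSpace ℂ H]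

theorem zpow_add_apply (V : H ≃ₗᵢ[ℂ] H) (p q : ℤ) (x : H) :
    (V ^ (p + q)) x = (V ^ p) ((V ^ q) x) := by
  rw [zpow_add]; rfl

theorem inner_zpow_zpow (V : H ≃ₗᵢ[ℂ] H) (p q : ℤ) (x y : H) :
    inner ℂ ((V ^ p) x) ((V ^ q) y) = inner ℂ ((V ^ (p - q)) x) y := by
  have : (V ^ p) x = (V ^ q) ((V ^ (p - q)) x) := by
    rw [← zpow_add_apply]
    congr 2; ring
  rw [this, LinearIsometryEquiv.inner_map_map]

theorem inner_zpow_left (V : H ≃ₗᵢ[ℂ] H) (p : ℤ) (x y : H) :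
    inner ℂ ((V ^ p) x) y = inner ℂ x ((V ^ (-p)) y) := by
  have := inner_zpow_zpow V 0 (-p) x y
  simpa using this.symm

theorem zpow_mul_apply_of_fixed {V : H ≃ₗᵢ[ℂ] H} {N : ℕ} {y : H} (h : (V ^ N) y = y) (k : ℤ) :
    (V ^ ((N : ℤ) * k)) y = y := by
  have h1 : (V ^ (N : ℤ)) y = y := by simpa using h
  have h2 : (V ^ (-(N : ℤ))) y = y := by
    conv_lhs => rw [← h1]
    rw [← zpow_add_apply]
    simp
  induction k using Int.induction_on with
  | zero => simp
  | succ i ih => rw [mul_add, mul_one, zpow_add_apply, h1, ih]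
  | pred i ih =>
    rw [mul_sub, mul_one, sub_eq_add_neg, zpow_add_apply, h2, ih]

theorem zpow_mem_closure_span (U : H ≃ₗᵢ[ℂ] H) (a : H) (k : ℤ) {x : H}
    (hx : x ∈ (Submodule.span ℂ (Set.range fun n : ℤ => (U ^ n) a)).topologicalClosure) :
    (U ^ k) x ∈ (Submodule.span ℂ (Set.range fun n : ℤ => (U ^ n) a)).topologicalClosure := by
  set K := (Submodule.span ℂ (Set.range fun n : ℤ => (U ^ n) a)).topologicalClosure
  have : K ≤ K.comap (U ^ k).toLinearEquiv.toLinearMap := by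
    refine Submodule.topologicalClosure_minimal _ (Submodule.span_le.2 ?_)
      ((Submodule.isClosed_topologicalClosure _).preimage (U ^ k).continuous)
    rintro _ ⟨n, rfl⟩
    refine Submodule.le_topologicalClosure _ (Submodule.subset_span ⟨k + n, ?_⟩)
    simp [zpow_add]
  exact this hx

end Shift

/-! ### The finite factor: cyclic spans and cross-covariance matrices. -/

section Finite

variable {H₂ : Type*} [NormedAddCommGroup H₂] [InnerProductSpace ℂ H₂]
  {V : H₂ ≃ₗᵢ[ℂ] H₂} {b : H₂} {N r' ℓ : ℕ}

/-- The span of the orbit of a periodic vector. -/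
def cyclicSpan (V : H₂ ≃ₗᵢ[ℂ] H₂) (b : H₂) (N : ℕ) : Submodule ℂ H₂ :=
  Submodule.span ℂ (Set.range fun p : Fin N => (V ^ (p : ℕ)) b)

instance : FiniteDimensional ℂ (cyclicSpan V b N) :=
  FiniteDimensional.span_of_finite ℂ (Set.finite_range _)

theorem zpow_apply_mem_cyclicSpan (hN : 0 < N) (hVb : (V ^ N) b = b) (k : ℤ) :
    (V ^ k) b ∈ cyclicSpan V b N := by
  have hN' : (0 : ℤ) < N := by exact_mod_cast hN
  have h0 := Int.emod_nonneg k hN'.ne'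
  have h1 := Int.emod_lt_of_pos k hN'
  refine Submodule.subset_span ⟨⟨(k % N).toNat, by omega⟩, ?_⟩
  have h2 : (V ^ (k % N).toNat) b = (V ^ (k % N)) b := by
    rw [← zpow_natCast, Int.toNat_of_nonneg h0]
  simp only [h2]
  conv_rhs => rw [← Int.emod_add_mul_ediv k N, zpow_add_apply,
    zpow_mul_apply_of_fixed hVb]

theorem zpow_mem_cyclicSpan (hN : 0 < N) (hVb : (V ^ N) b = b) (k : ℤ) {x : H₂}
    (hx : x ∈ cyclicSpan V b N) : (V ^ k) x ∈ cyclicSpan V b N := by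
  have : cyclicSpan V b N ≤ (cyclicSpan V b N).comap (V ^ k).toLinearEquiv.toLinearMap := by
    refine Submodule.span_le.2 ?_
    rintro _ ⟨p, rfl⟩
    have := zpow_apply_mem_cyclicSpan hN hVb (k + p)
    simpa [zpow_add] using this
  exact this hx

/-- Powers of `V` commute, so periodicity passes from `b` to its whole orbit and its span. -/
theorem pow_apply_of_mem_cyclicSpan (hVb : (V ^ N) b = b) {x : H₂}
    (hx : x ∈ cyclicSpan V b N) : (V ^ N) x = x := by
  have : cyclicSpan V b N ≤
      LinearMap.eqLocus (V ^ N).toLinearEquiv.toLinearMap LinearMap.id := by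
    refine Submodule.span_le.2 ?_
    rintro _ ⟨p, rfl⟩
    simp only [SetLike.mem_coe, LinearMap.mem_eqLocus]
    change (V ^ N) ((V ^ (p : ℕ)) b) = (V ^ (p : ℕ)) b
    have h : (V ^ N * V ^ (p : ℕ)) b = (V ^ (p : ℕ) * V ^ N) b := by
      rw [← pow_add, add_comm, pow_add]
    exact h.trans (congrArg (V ^ (p : ℕ)) hVb)
  exact this hx

/-- Row `(j', m)` of the cross-covariance matrix applied to `x` is the inner product of
`∑ p, x p • V ^ p b` with `V ^ (r' m) h_{j'}`. -/
theorem crossCovMatrix_mulVec (hVb : (V ^ N) b = b) (h₂ : Fin r' → H₂) (x : Fin N → ℂ)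
    (j : Fin r') (m : Fin ℓ) :
    (crossCovMatrix V b h₂ r' ℓ N).mulVec x (finProdFinEquiv (j, m)) =
      inner ℂ ((V ^ ((r' : ℤ) * ((m : ℕ) : ℤ))) (h₂ j)) (∑ p, x p • (V ^ (p : ℕ)) b) := by
  simp only [Matrix.mulVec, dotProduct, crossCovMatrix, Matrix.of_apply, crossCov,
    Equiv.symm_apply_apply, inner_sum, inner_smul_right]
  refine Finset.sum_congr rfl fun p _ => ?_
  rw [mul_comm]
  congr 1
  rw [inner_zpow_left, ← zpow_natCast V (p : ℕ), ← zpow_add_apply]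
  have h1 := zpow_mul_apply_of_fixed hVb 1
  rw [mul_one] at h1
  rw [sub_eq_add_neg, add_assoc, add_comm, zpow_add_apply, h1]

/-- An invertible cross-covariance matrix gives dual vectors whose shifts form a Riesz basis. -/
theorem exists_cyclic_dual (hN : 0 < N) (hVb : (V ^ N) b = b)
    (hb : LinearIndependent ℂ fun p : Fin N => (V ^ (p : ℕ)) b) (hℓ : r' * ℓ = N)
    (h₂ : Fin r' → H₂)
    (hR : IsUnit (Matrix.reindex (finCongr hℓ) (Equiv.refl (Fin N))
      (crossCovMatrix V b h₂ r' ℓ N))) :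
    ∃ d : Fin r' → H₂,
      IsRieszBasisOf (cyclicSpan V b N)
        (fun i : Fin r' × Fin ℓ => (V ^ ((r' : ℤ) * ((i.2 : ℕ) : ℤ))) (d i.1)) ∧
      ∀ i k : Fin r' × Fin ℓ, inner ℂ ((V ^ ((r' : ℤ) * ((i.2 : ℕ) : ℤ))) (h₂ i.1))
        ((V ^ ((r' : ℤ) * ((k.2 : ℕ) : ℤ))) (d k.1)) = if k = i then (1 : ℂ) else 0 := by
  have hℓ0 : 0 < ℓ := by
    rcases Nat.eq_zero_or_pos ℓ with h | h
    · subst h; omega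
    · exact h
  have hsurj := Matrix.mulVec_surjective_iff_isUnit.2 hR
  have hex : ∀ j : Fin r', ∃ d ∈ cyclicSpan V b N, ∀ (k : Fin r') (m : Fin ℓ),
      inner ℂ ((V ^ ((r' : ℤ) * ((m : ℕ) : ℤ))) (h₂ k)) d =
        if k = j ∧ (m : ℕ) = 0 then (1 : ℂ) else 0 := fun j => by
    -- The coordinates of `d j` solve the linear system whose right-hand side is the unit vector at
    -- row `(j, 0)`.
    obtain ⟨x, hx⟩ := hsurj (Pi.single (finCongr hℓ (finProdFinEquiv (j, ⟨0, hℓ0⟩))) 1)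
    refine ⟨∑ p, x p • (V ^ (p : ℕ)) b, Submodule.sum_mem _ fun p _ =>
      Submodule.smul_mem _ _ (Submodule.subset_span ⟨p, rfl⟩), fun k m => ?_⟩
    rw [← crossCovMatrix_mulVec hVb]
    have h3 := congrFun hx (finCongr hℓ (finProdFinEquiv (k, m)))
    have h4 : (Matrix.reindex (finCongr hℓ) (Equiv.refl (Fin N))
        (crossCovMatrix V b h₂ r' ℓ N)).mulVec x (finCongr hℓ (finProdFinEquiv (k, m))) =
        (crossCovMatrix V b h₂ r' ℓ N).mulVec x (finProdFinEquiv (k, m)) := rfl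
    rw [← h4, h3, Pi.single_apply]
    simp only [EmbeddingLike.apply_eq_iff_eq, Prod.mk.injEq, Fin.ext_iff]
  choose d hdK hd using hex
  have hbi : ∀ i k : Fin r' × Fin ℓ, inner ℂ ((V ^ ((r' : ℤ) * ((i.2 : ℕ) : ℤ))) (h₂ i.1))
        ((V ^ ((r' : ℤ) * ((k.2 : ℕ) : ℤ))) (d k.1)) = if k = i then (1 : ℂ) else 0 := by
    rintro ⟨i, m⟩ ⟨k, m'⟩
    have hℓ' : (0 : ℤ) < ℓ := by exact_mod_cast hℓ0
    -- The pairing depends only on `m - m'`. Splitting off its residue modulo `ℓ` leaves a power of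
    -- `V ^ N`, which is moved onto `d k`: vectors of the cyclic span are `N`-periodic, whereas the
    -- `h_{j'}` need not be.
    set q : ℤ := ((m : ℕ) : ℤ) - ((m' : ℕ) : ℤ) with hq
    have h0 := Int.emod_nonneg q hℓ'.ne'
    have h1 := Int.emod_lt_of_pos q hℓ'
    have h2 := Int.emod_add_mul_ediv q ℓ
    have key := hd k i ⟨(q % ℓ).toNat, by omega⟩
    simp only [Int.toNat_of_nonneg h0] at key
    rw [inner_zpow_zpow]
    have h5 : (V ^ ((r' : ℤ) * ((m : ℕ) : ℤ) - (r' : ℤ) * ((m' : ℕ) : ℤ))) (h₂ i) =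
        (V ^ ((N : ℤ) * (q / ℓ))) ((V ^ ((r' : ℤ) * (q % ℓ))) (h₂ i)) := by
      rw [← zpow_add_apply, ← mul_sub, ← hq]
      congr 2
      conv_lhs => rw [← h2]
      rw [← hℓ]; push_cast; ring
    rw [h5, inner_zpow_left, ← mul_neg, zpow_mul_apply_of_fixed
      (pow_apply_of_mem_cyclicSpan hVb (hdK k)), key]
    refine if_congr ?_ rfl rfl
    -- Since `|m - m'| < ℓ`, divisibility by `ℓ` forces equality.
    have h6 : (q % ℓ).toNat = 0 ↔ m = m' := by
      constructor
      · intro h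
        have : q % ℓ = 0 := by omega
        obtain ⟨t, ht⟩ := Int.dvd_of_emod_eq_zero this
        have hm := m.2
        have hm' := m'.2
        have : t = 0 := by
          by_contra h
          rcases lt_or_gt_of_ne h with h | h
          · nlinarith
          · nlinarith
        subst this
        ext; omega
      · rintro rfl
        simp [hq]
    rw [h6, Prod.mk.injEq]
    exact and_congr eq_comm eq_comm
  refine ⟨d, ?_, hbi⟩
  have hmem : ∀ i : Fin r' × Fin ℓ,
      (V ^ ((r' : ℤ) * ((i.2 : ℕ) : ℤ))) (d i.1) ∈ cyclicSpan V b N :=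
    fun i => zpow_mem_cyclicSpan hN hVb _ (hdK i.1)
  -- Biorthogonality gives independence, and the number of vectors `r' ℓ = N` is the dimension of
  -- the cyclic span.
  have hli : LinearIndependent ℂ (fun i : Fin r' × Fin ℓ =>
      (⟨_, hmem i⟩ : cyclicSpan V b N)) := by
    rw [Fintype.linearIndependent_iff]
    intro g hg i
    have := congrArg (fun y : cyclicSpan V b N =>
      inner ℂ ((V ^ ((r' : ℤ) * ((i.2 : ℕ) : ℤ))) (h₂ i.1)) (y : H₂)) hg
    simpa [inner_sum, inner_smul_right, hbi] using this
  have hcard : Fintype.card (Fin r' × Fin ℓ) = Module.finrank ℂ (cyclicSpan V b N) := by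
    rw [cyclicSpan, finrank_span_eq_card hb]
    simp [hℓ]
  have : Nonempty (Fin r' × Fin ℓ) := by
    rw [← Fintype.card_pos_iff]
    simpa [hℓ] using hN
  have hB := isRieszBasisOf_of_basis (basisOfLinearIndependentOfCardEqFinrank hli hcard)
  simpa using hB

/-- The cross-covariance matrix is invertible when no nonzero vector of the cyclic span is
orthogonal to all shifts of the `h_{j'}`. -/
theorem isUnit_crossCovMatrix (hVb : (V ^ N) b = b)
    (hb : LinearIndependent ℂ fun p : Fin N => (V ^ (p : ℕ)) b) (hℓ : r' * ℓ = N)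
    (h₂ : Fin r' → H₂)
    (h : ∀ v ∈ cyclicSpan V b N, (∀ (j : Fin r') (m : Fin ℓ),
      inner ℂ ((V ^ ((r' : ℤ) * ((m : ℕ) : ℤ))) (h₂ j)) v = (0 : ℂ)) → v = 0) :
    IsUnit (Matrix.reindex (finCongr hℓ) (Equiv.refl (Fin N))
      (crossCovMatrix V b h₂ r' ℓ N)) := by
  rw [← Matrix.mulVec_injective_iff_isUnit, ← Matrix.coe_mulVecLin, ← LinearMap.ker_eq_bot,
    LinearMap.ker_eq_bot']
  intro x hx
  have hv := h (∑ p, x p • (V ^ (p : ℕ)) b) (Submodule.sum_mem _ fun p _ =>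
      Submodule.smul_mem _ _ (Submodule.subset_span ⟨p, rfl⟩)) fun j m => by
    rw [← crossCovMatrix_mulVec hVb]
    exact congrFun hx (finCongr hℓ (finProdFinEquiv (j, m)))
  exact funext (Fintype.linearIndependent_iff.1 hb x hv)

end Finite

/-! ### The smallest eigenvalue as a bound for a quadratic form. -/

section Matrices

/-- The smallest eigenvalue of `A* A` is the best lower bound of the quadratic form `‖A X‖ ^ 2`. -/
theorem le_lambdaMin_iff {s r : ℕ} (hr : 0 < r) (A : Matrix (Fin s) (Fin r) ℂ) (c : ℝ) :
    c ≤ lambdaMin A ↔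
      ∀ X : Fin r → ℂ, c * ∑ k, ‖X k‖ ^ 2 ≤ ∑ j, ‖(A.mulVec X) j‖ ^ 2 := by
  have hne : Nonempty (Fin r) := ⟨⟨0, hr⟩⟩
  have hM := Matrix.isHermitian_conjTranspose_mul_self A
  have hquad : ∀ X : Fin r → ℂ,
      star X ⬝ᵥ ((A.conjTranspose * A).mulVec X) = ((∑ j, ‖(A.mulVec X) j‖ ^ 2 : ℝ) : ℂ) := by
    intro X
    rw [← Matrix.mulVec_mulVec, Matrix.dotProduct_mulVec, ← Matrix.star_mulVec]
    simp [dotProduct, Complex.conj_mul']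
  constructor
  · intro hc X
    let x : EuclideanSpace ℂ (Fin r) := WithLp.toLp 2 X
    let y : EuclideanSpace ℂ (Fin r) := WithLp.toLp 2 ((A.conjTranspose * A).mulVec X)
    have h1 : (inner ℂ x y : ℂ) = ((∑ j, ‖(A.mulVec X) j‖ ^ 2 : ℝ) : ℂ) := by
      rw [← hquad, EuclideanSpace.inner_eq_star_dotProduct, dotProduct_comm]
    have h2 : ∀ i, inner ℂ (hM.eigenvectorBasis i) y =
        (hM.eigenvalues i : ℂ) * inner ℂ (hM.eigenvectorBasis i) x := by
      intro i
      simp only [EuclideanSpace.inner_eq_star_dotProduct, x, y]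
      have h6 : ∀ v, Matrix.vecMul (star v) (A.conjTranspose * A) =
          star ((A.conjTranspose * A).mulVec v) := fun v => by rw [Matrix.star_mulVec, hM.eq]
      rw [dotProduct_comm, Matrix.dotProduct_mulVec, h6, hM.mulVec_eigenvectorBasis,
        dotProduct_comm]
      simp [dotProduct, Finset.mul_sum]
      refine Finset.sum_congr rfl fun k _ => by ring
    -- Expanding `⟨X, A* A X⟩` in the eigenvector basis diagonalizes the energy into `∑ λ_i |⟨e_i,
    -- X⟩|²`.
    have h3 := hM.eigenvectorBasis.sum_inner_mul_inner x y
    rw [h1] at h3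
    have h4 : ∀ i, inner ℂ x (hM.eigenvectorBasis i) * inner ℂ (hM.eigenvectorBasis i) y =
        ((hM.eigenvalues i * ‖(inner ℂ (hM.eigenvectorBasis i) x : ℂ)‖ ^ 2 : ℝ) : ℂ) := by
      intro i
      rw [h2, ← inner_conj_symm]
      push_cast
      rw [← Complex.conj_mul']
      ring
    simp only [h4] at h3
    have h5 : ∑ i, hM.eigenvalues i * ‖(inner ℂ (hM.eigenvectorBasis i) x : ℂ)‖ ^ 2 =
        ∑ j, ‖(A.mulVec X) j‖ ^ 2 := by exact_mod_cast h3
    rw [← h5]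
    have h6 : ∑ k, ‖X k‖ ^ 2 = ∑ i, ‖(inner ℂ (hM.eigenvectorBasis i) x : ℂ)‖ ^ 2 := by
      rw [hM.eigenvectorBasis.sum_sq_norm_inner_right x, EuclideanSpace.norm_sq_eq]
    rw [h6, Finset.mul_sum]
    gcongr with i
    exact hc.trans (ciInf_le (Set.finite_range _).bddBelow i)
  · intro h
    refine le_ciInf fun i => ?_
    have h1 := h (hM.eigenvectorBasis i)
    have h2 := hquad (hM.eigenvectorBasis i)
    rw [hM.mulVec_eigenvectorBasis] at h2
    have h3 : ∑ k, ‖hM.eigenvectorBasis i k‖ ^ 2 = 1 := by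
      rw [← EuclideanSpace.norm_sq_eq, hM.eigenvectorBasis.norm_eq_one, one_pow]
    rw [h3, mul_one] at h1
    have h4 : star (⇑(hM.eigenvectorBasis i)) ⬝ᵥ (hM.eigenvalues i • ⇑(hM.eigenvectorBasis i)) =
        ((hM.eigenvalues i * ∑ k, ‖hM.eigenvectorBasis i k‖ ^ 2 : ℝ) : ℂ) := by
      rw [dotProduct_smul]
      simp [dotProduct, Complex.conj_mul']
    rw [h4, h3, mul_one] at h2
    have h5 := Complex.ofReal_injective h2
    rw [← h5] at h1
    exact h1

end Matrices

/-! ### Translations by `k / r` and decimation of Fourier coefficients. -/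

section Circle

open MeasureTheory AddCircle

/-- The point `k / r` of the circle. -/
noncomputable def rootPoint (r : ℕ) (k : Fin r) : AddCircle (1 : ℝ) :=
  (((k : ℕ) : ℝ) / (r : ℝ) : ℝ)

theorem rootPoint_add {r : ℕ} [NeZero r] (k m : Fin r) :
    rootPoint r (k + m) = rootPoint r k + rootPoint r m := by
  have hr : (r : ℝ) ≠ 0 := by exact_mod_cast NeZero.ne r
  rw [rootPoint, rootPoint, rootPoint, ← AddCircle.coe_add, Fin.val_add, ← sub_eq_zero,
    ← AddCircle.coe_sub, AddCircle.coe_eq_zero_iff]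
  -- Addition in `Fin r` wraps around; `q` is the integer lost in the wrapping, which is zero on the
  -- circle.
  obtain ⟨q, hq⟩ : ∃ q : ℕ, q = ((k : ℕ) + (m : ℕ)) / r := ⟨_, rfl⟩
  have h : ((((k : ℕ) + (m : ℕ)) % r : ℕ) : ℝ) + (r : ℝ) * (q : ℝ) =
      (k : ℕ) + (m : ℕ) := by rw [hq]; exact_mod_cast Nat.mod_add_div _ _
  refine ⟨-(q : ℤ), ?_⟩
  simp only [zsmul_eq_mul, mul_one]
  push_cast
  field_simp
  linarith

theorem sum_rootPoint_add {r : ℕ} [NeZero r] {E : Type*} [AddCommMonoid E]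
    (f : AddCircle (1 : ℝ) → E) (y : AddCircle (1 : ℝ)) (m : Fin r) :
    ∑ k, f (y + rootPoint r m + rootPoint r k) = ∑ k, f (y + rootPoint r k) := by
  rw [← Equiv.sum_comp (Equiv.addLeft m) fun k => f (y + rootPoint r k)]
  simp [rootPoint_add, add_assoc]

theorem fourier_rootPoint {r : ℕ} (m : ℤ) (k : Fin r) :
    fourier m (rootPoint r k) = Complex.exp (2 * Real.pi * Complex.I * (m / r)) ^ (k : ℕ) := by
  rw [rootPoint, fourier_coe_apply, ← Complex.exp_nat_mul]
  congr 1
  push_cast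
  ring

theorem fourier_rootPoint_of_dvd {r : ℕ} [NeZero r] {m : ℤ} (h : (r : ℤ) ∣ m) (k : Fin r) :
    fourier m (rootPoint r k) = 1 := by
  obtain ⟨n, rfl⟩ := h
  have hr : (r : ℂ) ≠ 0 := by exact_mod_cast NeZero.ne r
  rw [fourier_rootPoint]
  have : 2 * Real.pi * Complex.I * (((r : ℤ) * n : ℤ) / r : ℂ) = n * (2 * Real.pi * Complex.I) := by
    push_cast
    field_simp
  rw [this, Complex.exp_int_mul_two_pi_mul_I, one_pow]

/-- The summands are the powers of a single `r`-th root of unity, equal to `1` exactly when `r ∣ m`;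
otherwise the geometric sum vanishes. -/
theorem sum_fourier_rootPoint {r : ℕ} [NeZero r] (m : ℤ) :
    ∑ k : Fin r, fourier m (rootPoint r k) = if (r : ℤ) ∣ m then (r : ℂ) else 0 := by
  split_ifs with h
  · simp [fourier_rootPoint_of_dvd h]
  · have hr : (r : ℂ) ≠ 0 := by exact_mod_cast NeZero.ne r
    simp only [fourier_rootPoint]
    rw [Fin.sum_univ_eq_sum_range
      (fun k => Complex.exp (2 * Real.pi * Complex.I * (m / r)) ^ k), geom_sum_eq]
    · rw [← Complex.exp_nat_mul]
      have : (r : ℂ) * (2 * Real.pi * Complex.I * (m / r)) = m * (2 * Real.pi * Complex.I) := by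
        field_simp
      rw [this, Complex.exp_int_mul_two_pi_mul_I]
      simp
    · intro h1
      rw [Complex.exp_eq_one_iff] at h1
      obtain ⟨n, hn⟩ := h1
      apply h
      refine ⟨n, ?_⟩
      have h2 : (m : ℂ) / r = n := by
        have := Complex.two_pi_I_ne_zero
        apply mul_left_cancel₀ this
        rw [hn]; ring
      rw [div_eq_iff hr] at h2
      have : m = n * (r : ℤ) := by exact_mod_cast h2
      rw [this, mul_comm]

/-- Translation invariance of Haar measure, with the character absorbing the shift. -/
theorem fourierCoeff_add_right (p : AddCircle (1 : ℝ) → ℂ) (t : AddCircle (1 : ℝ)) (m : ℤ) :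
    fourierCoeff (fun y => p (y + t)) m = fourier m t * fourierCoeff p m := by
  simp only [fourierCoeff, smul_eq_mul]
  rw [← integral_add_right_eq_self (μ := haarAddCircle)
    (fun y : AddCircle (1 : ℝ) => fourier (-m) y * p y) t, ← integral_const_mul]
  refine integral_congr_ae (Filter.Eventually.of_forall fun y => ?_)
  have h : fourier m t * fourier (-m) (y + t) = fourier (-m) y := by
    rw [fourier_apply, fourier_apply, fourier_apply, ← Circle.coe_mul, ← AddCircle.toCircle_add]
    congr 2
    simp [smul_add]
  simp only
  rw [← mul_assoc, h]

/-- The average of a function over the translates by `k / r`. -/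
noncomputable def rootAverage (r : ℕ) (p : AddCircle (1 : ℝ) → ℂ) (y : AddCircle (1 : ℝ)) : ℂ :=
  (r : ℂ)⁻¹ * ∑ k : Fin r, p (y + rootPoint r k)

theorem memLp_comp_add_right {p : AddCircle (1 : ℝ) → ℂ} {q : ℝ≥0∞}
    (hp : MemLp p q haarAddCircle) (t : AddCircle (1 : ℝ)) :
    MemLp (fun y => p (y + t)) q haarAddCircle :=
  hp.comp_measurePreserving (measurePreserving_add_right haarAddCircle t)

theorem memLp_rootAverage {r : ℕ} {p : AddCircle (1 : ℝ) → ℂ} (hp : MemLp p 2 haarAddCircle) :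
    MemLp (rootAverage r p) 2 haarAddCircle :=
  (memLp_finsetSum Finset.univ
    fun k _ => memLp_comp_add_right hp (rootPoint r k)).const_mul _

/-- Each translate multiplies the coefficient by a character value, and the sum of these values
keeps only `m ∈ r ℤ`: averaging in space is decimation in frequency. -/
theorem fourierCoeff_rootAverage {r : ℕ} [NeZero r] {p : AddCircle (1 : ℝ) → ℂ}
    (hp : MemLp p 2 haarAddCircle) (m : ℤ) :
    fourierCoeff (rootAverage r p) m = if (r : ℤ) ∣ m then fourierCoeff p m else 0 := by
  have hr : (r : ℂ) ≠ 0 := by exact_mod_cast NeZero.ne r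
  have h1 : fourierCoeff (rootAverage r p) m =
      (r : ℂ)⁻¹ * ∑ k : Fin r, fourierCoeff (fun y => p (y + rootPoint r k)) m := by
    unfold rootAverage
    rw [fourierCoeff.const_mul]
    congr 1
    have := fourierCoeff.sum (T := 1) Finset.univ (fun (k : Fin r) y => p (y + rootPoint r k))
      (fun k _ => (memLp_comp_add_right hp (rootPoint r k)).integrable (by norm_num))
    have h := congrFun this m
    simp only [Finset.sum_apply] at h
    rw [← h]
    congr 1
    funext y
    simp
  rw [h1]
  simp only [fourierCoeff_add_right]
  rw [← Finset.sum_mul, sum_fourier_rootPoint]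
  split_ifs
  · field_simp
  · simp

theorem hasSum_sq_fourierCoeff_of_memLp {p : AddCircle (1 : ℝ) → ℂ}
    (hp : MemLp p 2 haarAddCircle) :
    HasSum (fun m => ‖fourierCoeff p m‖ ^ 2) (∫ y, ‖p y‖ ^ 2 ∂haarAddCircle) := by
  have h := hasSum_sq_fourierCoeff hp.toLp
  have h1 : ∀ m, fourierCoeff hp.toLp m = fourierCoeff p m := fun m =>
    congrFun (fourierCoeff_congr_ae hp.coeFn_toLp) m
  simp only [h1] at h
  convert h using 1
  exact integral_congr_ae (hp.coeFn_toLp.mono fun y hy => by simp [hy])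

/-- Parseval's identity for the Fourier coefficients along a subgroup. -/
theorem hasSum_sq_fourierCoeff_mul {r : ℕ} [NeZero r] {p : AddCircle (1 : ℝ) → ℂ}
    (hp : MemLp p 2 haarAddCircle) :
    HasSum (fun n : ℤ => ‖fourierCoeff p (r * n)‖ ^ 2)
      (∫ y, ‖rootAverage r p y‖ ^ 2 ∂haarAddCircle) := by
  have h := hasSum_sq_fourierCoeff_of_memLp (memLp_rootAverage (r := r) hp)
  have hinj : Function.Injective fun n : ℤ => (r : ℤ) * n := fun m n hmn => by
    have hr : (r : ℤ) ≠ 0 := by exact_mod_cast NeZero.ne r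
    exact mul_left_cancel₀ hr hmn
  rw [← hinj.hasSum_iff] at h
  · convert h using 2 with n
    simp [fourierCoeff_rootAverage hp]
  · intro m hm
    have : ¬ (r : ℤ) ∣ m := fun ⟨n, hn⟩ => hm ⟨n, hn.symm⟩
    simp [fourierCoeff_rootAverage hp, this]

end Circle

/-! ### Null sets and integrals: passing between intervals and the circle. -/

section CircleMeasure

open MeasureTheory AddCircle

theorem ae_circle_of_ae_Ioo {P : AddCircle (1 : ℝ) → Prop}
    (h : ∀ᵐ x : ℝ ∂volume.restrict (Set.Ioo (0 : ℝ) 1), P x) :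
    ∀ᵐ y ∂(haarAddCircle (T := (1 : ℝ))), P y := by
  have hvol : (volume : Measure (AddCircle (1 : ℝ))) = haarAddCircle := by
    rw [volume_eq_smul_haarAddCircle]; simp
  have h1 : ∀ᵐ x : ℝ ∂volume.restrict (Set.Ioc (0 : ℝ) (0 + 1)), P x := by
    rw [zero_add, ← Measure.restrict_congr_set Ioo_ae_eq_Ioc]
    exact h
  have h2 : ∀ᵐ z : Set.Ioc (0 : ℝ) (0 + 1) ∂(Measure.comap Subtype.val volume), P (z : ℝ) :=
    (ae_restrict_iff_subtype measurableSet_Ioc).1 h1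
  have h3 := (measurePreserving_equivIoc (T := (1 : ℝ)) (a := 0)).quasiMeasurePreserving.ae h2
  rw [hvol] at h3
  simpa using h3

theorem ae_Ioo_of_ae_circle {P : AddCircle (1 : ℝ) → Prop} {t : ℝ} (ht : t ≤ 1)
    (h : ∀ᵐ y ∂(haarAddCircle (T := (1 : ℝ))), P y) :
    ∀ᵐ x : ℝ ∂volume.restrict (Set.Ioo (0 : ℝ) t), P x := by
  have hvol : (volume : Measure (AddCircle (1 : ℝ))) = haarAddCircle := by
    rw [volume_eq_smul_haarAddCircle]; simp
  rw [← hvol] at h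
  have h3 := (AddCircle.measurePreserving_mk (1 : ℝ) 0).quasiMeasurePreserving.ae h
  refine ae_mono (Measure.restrict_mono ?_ le_rfl) h3
  intro x hx
  exact ⟨hx.1, by linarith [hx.2]⟩

/-- A property invariant under the translations by `k / r` holds almost everywhere on the circle
if it does on `(0, 1 / r)`. -/
theorem ae_circle_of_ae_Ioo_div {r : ℕ} [NeZero r] {P : AddCircle (1 : ℝ) → Prop}
    (hP : ∀ y k, P y → P (y + rootPoint r k))
    (h : ∀ᵐ x : ℝ ∂volume.restrict (Set.Ioo (0 : ℝ) (1 / (r : ℝ))), P x) :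
    ∀ᵐ y ∂(haarAddCircle (T := (1 : ℝ))), P y := by
  have hr : (0 : ℝ) < r := by exact_mod_cast NeZero.pos r
  refine ae_circle_of_ae_Ioo ?_
  rw [ae_restrict_iff' measurableSet_Ioo] at h ⊢
  have h1 : ∀ᵐ x : ℝ, ∀ k : Fin r, x - (k : ℕ) / (r : ℝ) ∈ Set.Ioo (0 : ℝ) (1 / (r : ℝ)) →
      P ((x - (k : ℕ) / (r : ℝ) : ℝ) : AddCircle (1 : ℝ)) := by
    rw [ae_all_iff]
    exact fun k => (measurePreserving_sub_right volume
      ((k : ℕ) / (r : ℝ))).quasiMeasurePreserving.ae h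
  -- The index `⌊r x⌋` carries `x` back into `(0, 1 / r)`, except at the points `k / r` themselves,
  -- which land on the excluded endpoint `0`.
  have h2 : ∀ᵐ x : ℝ, ∀ k : Fin r, x ≠ (k : ℕ) / (r : ℝ) := by
    rw [ae_all_iff]
    exact fun k => Measure.ae_ne volume _
  filter_upwards [h1, h2] with x hx hx2 hx01
  have hlt : ⌊(r : ℝ) * x⌋₊ < r := by
    rw [Nat.floor_lt (mul_nonneg hr.le hx01.1.le)]
    nlinarith [hx01.2]
  have hfl := Nat.floor_le (mul_nonneg hr.le hx01.1.le)
  have hfl2 := Nat.lt_floor_add_one ((r : ℝ) * x)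
  have hne := hx2 ⟨_, hlt⟩
  have h3 := hx ⟨_, hlt⟩ ⟨?_, ?_⟩
  · have h4 := hP _ ⟨_, hlt⟩ h3
    rw [rootPoint, ← AddCircle.coe_add] at h4
    simpa using h4
  · have h5 : (⌊(r : ℝ) * x⌋₊ : ℝ) / r ≤ x := by
      rw [div_le_iff₀ hr]; linarith
    exact sub_pos.2 (lt_of_le_of_ne h5 (Ne.symm hne))
  · rw [sub_lt_iff_lt_add, ← add_div, lt_div_iff₀ hr]
    simp only
    linarith

theorem norm_sq_eq_integral (F : Lp ℂ 2 (haarAddCircle (T := (1 : ℝ)))) :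
    ‖F‖ ^ 2 = ∫ y, ‖F y‖ ^ 2 ∂haarAddCircle := by
  have h : (inner ℂ F F : ℂ) = ((∫ y, ‖F y‖ ^ 2 ∂haarAddCircle : ℝ) : ℂ) := by
    rw [L2.inner_def, ← integral_complex_ofReal]
    refine integral_congr_ae (Filter.Eventually.of_forall fun y => ?_)
    simp
  rw [inner_self_eq_norm_sq_to_K] at h
  refine Complex.ofReal_inj.1 (Eq.trans ?_ h)
  push_cast
  rfl

end CircleMeasure

/-! ### The `L²` model of the closed span and the symbols `g_j`. -/

section Symbol

open MeasureTheory AddCircle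

variable {H₁ : Type*} [NormedAddCommGroup H₁] [InnerProductSpace ℂ H₁]
  {U : H₁ ≃ₗᵢ[ℂ] H₁} {a : H₁}

/-- A Riesz sequence `U ^ n a` identifies its closed span with `L²` of the circle. -/
theorem IsRieszSequence.exists_circle_equiv (ha : IsRieszSequence fun n : ℤ => (U ^ n) a) :
    ∃ Φ : Lp ℂ 2 (haarAddCircle (T := (1 : ℝ))) ≃L[ℂ]
        (Submodule.span ℂ (Set.range fun n : ℤ => (U ^ n) a)).topologicalClosure,
      ∀ n : ℤ, (Φ (fourierLp 2 n) : H₁) = (U ^ n) a := by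
  obtain ⟨L, hL⟩ := ha.exists_equiv
  refine ⟨fourierBasis.repr.toContinuousLinearEquiv.trans L, fun n => ?_⟩
  have h := (fourierBasis (T := (1 : ℝ))).repr_self n
  rw [coe_fourierBasis] at h
  simp [hL n, h]

/-- The coefficients are conjugates of the Fourier coefficients of `Φ* h` at `-k`, hence square
summable. So the `tsum` in `gL2` is a genuine sum in `L²` and not the default value `0`. -/
theorem fourierCoeff_gL2 [CompleteSpace H₁]
    (Φ : Lp ℂ 2 (haarAddCircle (T := (1 : ℝ))) →L[ℂ] H₁)
    (hΦ : ∀ n : ℤ, Φ (fourierLp 2 n) = (U ^ n) a) (h : H₁) (k : ℤ) :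
    fourierCoeff (gL2 U a h) k = inner ℂ ((U ^ k) h) a := by
  have h1 : ∀ k : ℤ, (inner ℂ ((U ^ k) h) a : ℂ) =
      (starRingEnd ℂ) (fourierBasis.repr (ContinuousLinearMap.adjoint Φ h) (-k)) := fun k => by
    rw [fourierBasis.repr_apply_apply, coe_fourierBasis, ContinuousLinearMap.adjoint_inner_right,
      hΦ, inner_conj_symm, inner_zpow_left]
  have hs : Memℓp (fun k : ℤ => (inner ℂ ((U ^ k) h) a : ℂ)) 2 := by
    refine memℓp_gen ?_
    have h2 := lp.hasSum_norm (p := 2) (by norm_num)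
      (fourierBasis.repr (ContinuousLinearMap.adjoint Φ h))
    have h3 := ((Equiv.neg ℤ).hasSum_iff.2 h2).summable
    refine h3.congr fun k => ?_
    rw [h1]
    simp
  have h2 := (fourierBasis (T := (1 : ℝ))).hasSum_repr_symm ⟨_, hs⟩
  have h3 : gL2 U a h = (fourierBasis (T := (1 : ℝ))).repr.symm ⟨_, hs⟩ := by
    rw [gL2, ← h2.tsum_eq]
    simp [coe_fourierBasis]
  rw [← fourierBasis_repr, h3, LinearIsometryEquiv.apply_symm_apply]

/-- The inner products with `U ^ k h` are the Fourier coefficients of the product with the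
symbol. -/
theorem inner_zpow_eq_fourierCoeff [CompleteSpace H₁]
    (Φ : Lp ℂ 2 (haarAddCircle (T := (1 : ℝ))) →L[ℂ] H₁)
    (hΦ : ∀ n : ℤ, Φ (fourierLp 2 n) = (U ^ n) a) (h : H₁) (k : ℤ)
    (F : Lp ℂ 2 (haarAddCircle (T := (1 : ℝ)))) :
    inner ℂ ((U ^ k) h) (Φ F) = fourierCoeff (fun y => gL2 U a h y * F y) k := by
  -- The candidate for `Φ* (U ^ k h)`: the conjugate symbol times a character, identified below by
  -- its Fourier coefficients.
  let w : AddCircle (1 : ℝ) → ℂ := fun y => (starRingEnd ℂ) (gL2 U a h y) * fourier k y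
  have hw : MemLp w 2 haarAddCircle := by
    refine (Lp.memLp (gL2 U a h)).of_le ?_ (Filter.Eventually.of_forall fun y => ?_)
    · exact (continuous_star.comp_aestronglyMeasurable (Lp.aestronglyMeasurable _)).mul
        (fourier k).continuous.aestronglyMeasurable
    · simp [w, fourier_apply, Circle.norm_coe]
  have hφ : ContinuousLinearMap.adjoint Φ ((U ^ k) h) = hw.toLp := by
    apply fourierBasis.repr.injective
    ext m
    rw [fourierBasis_repr hw.toLp, fourierBasis.repr_apply_apply, coe_fourierBasis,
      ContinuousLinearMap.adjoint_inner_right, hΦ, fourierCoeff_congr_ae hw.coeFn_toLp,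
      inner_zpow_zpow, ← inner_conj_symm]
    have h1 : (U ^ (m - k)) a = (U ^ (-(k - m))) a := by congr 2; ring
    rw [h1, ← inner_zpow_left, ← fourierCoeff_gL2 Φ hΦ, fourierCoeff, fourierCoeff,
      ← integral_conj]
    refine integral_congr_ae (Filter.Eventually.of_forall fun y => ?_)
    simp only [w, smul_eq_mul, map_mul, ← fourier_neg]
    have : -(-(k - m)) = k + -m := by ring
    rw [this, fourier_add]
    ring
  rw [← ContinuousLinearMap.adjoint_inner_left, hφ, L2.inner_def, fourierCoeff]
  refine integral_congr_ae (hw.coeFn_toLp.mono fun y hy => ?_)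
  simp only [RCLike.inner_apply, hy, w, map_mul, Complex.conj_conj, smul_eq_mul, fourier_neg]
  ring

theorem exists_ae_norm_gL2_le {r : ℕ} {h : Fin r → H₁}
    (hg : ∀ j, MemLp (gFun U a (h j)) ∞ (volume.restrict (Set.Ioo (0 : ℝ) 1))) :
    ∃ M : ℝ, 0 ≤ M ∧ ∀ j, ∀ᵐ y ∂(haarAddCircle (T := (1 : ℝ))), ‖gL2 U a (h j) y‖ ≤ M := by
  have hj : ∀ j, ∃ M : ℝ, 0 ≤ M ∧
      ∀ᵐ y ∂(haarAddCircle (T := (1 : ℝ))), ‖gL2 U a (h j) y‖ ≤ M := fun j => by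
    refine ⟨(eLpNorm (gFun U a (h j)) ∞ (volume.restrict (Set.Ioo (0 : ℝ) 1))).toReal,
      ENNReal.toReal_nonneg, ae_circle_of_ae_Ioo ?_⟩
    have h1 := ae_le_eLpNormEssSup (f := gFun U a (h j))
      (μ := volume.restrict (Set.Ioo (0 : ℝ) 1))
    filter_upwards [h1] with x hx
    rw [← eLpNorm_exponent_top] at hx
    have := ENNReal.toReal_mono (hg j).2.ne hx
    simpa [gFun] using this
  choose M hM0 hM using hj
  refine ⟨∑ j, M j, Finset.sum_nonneg fun j _ => hM0 j, fun j => (hM j).mono fun y hy => ?_⟩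
  exact hy.trans (Finset.single_le_sum (fun i _ => hM0 i) (Finset.mem_univ j))

end Symbol

/-! ### Multiplication by the symbols: energy, frame bounds and dense range. -/

section Multiplier

open MeasureTheory AddCircle

/-- With finitely many fibres, each can be extended by zero and the sums added, so neither
completeness nor absolute convergence is needed. -/
theorem hasSum_prod_of_fintype {ι κ E : Type*} [Fintype ι] [AddCommMonoid E] [TopologicalSpace E]
    [ContinuousAdd E] {f : ι × κ → E} {s : ι → E} (h : ∀ i, HasSum (fun k => f (i, k)) (s i)) :
    HasSum f (∑ i, s i) := by
  classical
  have h1 : ∀ i, HasSum (fun x : ι × κ => if x.1 = i then f x else 0) (s i) := fun i => by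
    rw [← (Prod.mk_right_injective i).hasSum_iff]
    · simpa [Function.comp_def] using h i
    · rintro ⟨j, k⟩ hjk
      have : j ≠ i := fun hj => hjk ⟨k, by simp [hj]⟩
      simp [this]
  refine (hasSum_sum fun i _ => h1 i).congr_fun fun x => ?_
  simp

variable {r : ℕ} {g : Fin r → AddCircle (1 : ℝ) → ℂ} {M : ℝ}

/-- The matrix `g_j (y + k / r)`. -/
noncomputable def symbolMatrix (g : Fin r → AddCircle (1 : ℝ) → ℂ) (y : AddCircle (1 : ℝ)) :
    Matrix (Fin r) (Fin r) ℂ :=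
  Matrix.of fun j k => g j (y + rootPoint r k)

theorem symbolMatrix_mulVec (F : AddCircle (1 : ℝ) → ℂ) (y : AddCircle (1 : ℝ)) (j : Fin r) :
    (symbolMatrix g y).mulVec (fun k => F (y + rootPoint r k)) j =
      ∑ k, g j (y + rootPoint r k) * F (y + rootPoint r k) := rfl

theorem memLp_mul_of_bound {f F : AddCircle (1 : ℝ) → ℂ}
    (hf : AEStronglyMeasurable f haarAddCircle) (hM : ∀ᵐ y ∂haarAddCircle, ‖f y‖ ≤ M)
    (hF : MemLp F 2 haarAddCircle) : MemLp (fun y => f y * F y) 2 haarAddCircle := by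
  refine hF.of_le_mul (c := M) (hf.mul hF.1) (hM.mono fun y hy => ?_)
  rw [norm_mul]
  gcongr

theorem integrable_symbolMatrix_mulVec [NeZero r]
    (hgm : ∀ j, AEStronglyMeasurable (g j) haarAddCircle)
    (hgM : ∀ j, ∀ᵐ y ∂haarAddCircle, ‖g j y‖ ≤ M) {F : AddCircle (1 : ℝ) → ℂ}
    (hF : MemLp F 2 haarAddCircle) (j : Fin r) :
    Integrable (fun y => ‖(symbolMatrix g y).mulVec (fun k => F (y + rootPoint r k)) j‖ ^ 2)
      haarAddCircle := by
  have hr : (r : ℂ) ≠ 0 := by exact_mod_cast NeZero.ne r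
  have h := ((memLp_rootAverage (r := r) (memLp_mul_of_bound (hgm j) (hgM j) hF)).const_mul
    (r : ℂ)).integrable_norm_pow (by norm_num)
  refine h.congr (Filter.Eventually.of_forall fun y => ?_)
  simp only [symbolMatrix_mulVec, rootAverage]
  rw [← mul_assoc, mul_inv_cancel₀ hr, one_mul]

/-- The energy of the decimated Fourier coefficients of the products with the symbols. -/
theorem hasSum_sq_fourierCoeff_symbol [NeZero r]
    (hgm : ∀ j, AEStronglyMeasurable (g j) haarAddCircle)
    (hgM : ∀ j, ∀ᵐ y ∂haarAddCircle, ‖g j y‖ ≤ M) {F : AddCircle (1 : ℝ) → ℂ}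
    (hF : MemLp F 2 haarAddCircle) :
    HasSum (fun i : Fin r × ℤ => ‖fourierCoeff (fun y => g i.1 y * F y) (r * i.2)‖ ^ 2)
      (((r : ℝ) ^ 2)⁻¹ * ∫ y, ∑ j,
        ‖(symbolMatrix g y).mulVec (fun k => F (y + rootPoint r k)) j‖ ^ 2 ∂haarAddCircle) := by
  rw [integral_finsetSum _ fun j _ => integrable_symbolMatrix_mulVec hgm hgM hF j,
    Finset.mul_sum]
  refine hasSum_prod_of_fintype fun j => ?_
  have h := hasSum_sq_fourierCoeff_mul (r := r) (memLp_mul_of_bound (hgm j) (hgM j) hF)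
  convert h using 1
  rw [← integral_const_mul]
  refine integral_congr_ae (Filter.Eventually.of_forall fun y => ?_)
  simp only [symbolMatrix_mulVec, rootAverage]
  rw [norm_mul, mul_pow]
  simp

theorem integral_sq_eq_rootPoint [NeZero r] {F : AddCircle (1 : ℝ) → ℂ}
    (hF : MemLp F 2 haarAddCircle) :
    ∫ y, ‖F y‖ ^ 2 ∂haarAddCircle =
      (r : ℝ)⁻¹ * ∫ y, ∑ k, ‖F (y + rootPoint r k)‖ ^ 2 ∂haarAddCircle := by
  have hr : (r : ℝ) ≠ 0 := by exact_mod_cast NeZero.ne r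
  rw [integral_finsetSum _ fun k _ =>
    (memLp_comp_add_right hF (rootPoint r k)).integrable_norm_pow (by norm_num)]
  have h : ∀ k : Fin r, ∫ y, ‖F (y + rootPoint r k)‖ ^ 2 ∂haarAddCircle =
      ∫ y, ‖F y‖ ^ 2 ∂haarAddCircle := fun k =>
    integral_add_right_eq_self (μ := haarAddCircle) (fun y => ‖F y‖ ^ 2) (rootPoint r k)
  simp only [h, Finset.sum_const, Finset.card_univ, Fintype.card_fin, nsmul_eq_mul]
  field_simp

/-- The pointwise bound is integrated at the vector of translates of `F`. The energy formula
contributes `r⁻²`, and the `r` translates, having equal integrals, contribute `r`. -/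
theorem symbol_lower_bound [NeZero r]
    (hgm : ∀ j, AEStronglyMeasurable (g j) haarAddCircle)
    (hgM : ∀ j, ∀ᵐ y ∂haarAddCircle, ‖g j y‖ ≤ M) {c : ℝ}
    (hc : ∀ᵐ y ∂haarAddCircle, ∀ X : Fin r → ℂ,
      c * ∑ k, ‖X k‖ ^ 2 ≤ ∑ j, ‖(symbolMatrix g y).mulVec X j‖ ^ 2)
    {F : AddCircle (1 : ℝ) → ℂ} (hF : MemLp F 2 haarAddCircle) :
    (r : ℝ)⁻¹ * c * ∫ y, ‖F y‖ ^ 2 ∂haarAddCircle ≤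
      ∑' i : Fin r × ℤ, ‖fourierCoeff (fun y => g i.1 y * F y) (r * i.2)‖ ^ 2 := by
  have hr : (r : ℝ) ≠ 0 := by exact_mod_cast NeZero.ne r
  rw [(hasSum_sq_fourierCoeff_symbol hgm hgM hF).tsum_eq, integral_sq_eq_rootPoint (r := r) hF]
  have h : c * ∫ y, ∑ k, ‖F (y + rootPoint r k)‖ ^ 2 ∂haarAddCircle ≤
      ∫ y, ∑ j, ‖(symbolMatrix g y).mulVec (fun k => F (y + rootPoint r k)) j‖ ^ 2
        ∂haarAddCircle := by
    rw [← integral_const_mul]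
    refine integral_mono_ae ?_ ?_ (hc.mono fun y hy => hy _)
    · exact (integrable_finsetSum _ fun k _ =>
        (memLp_comp_add_right hF (rootPoint r k)).integrable_norm_pow (by norm_num)).const_mul _
    · exact integrable_finsetSum _ fun j _ => integrable_symbolMatrix_mulVec hgm hgM hF j
  calc _ = ((r : ℝ) ^ 2)⁻¹ * (c * ∫ y, ∑ k, ‖F (y + rootPoint r k)‖ ^ 2 ∂haarAddCircle) := by
        rw [sq, mul_inv]; ring
    _ ≤ _ := by gcongr

/-- The decimated energy of each `g_j F` is at most its full energy, which is at most `M² ‖F‖²`;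
there are `r` symbols. -/
theorem symbol_upper_bound [NeZero r]
    (hgm : ∀ j, AEStronglyMeasurable (g j) haarAddCircle)
    (hgM : ∀ j, ∀ᵐ y ∂haarAddCircle, ‖g j y‖ ≤ M)
    {F : AddCircle (1 : ℝ) → ℂ} (hF : MemLp F 2 haarAddCircle) :
    ∑' i : Fin r × ℤ, ‖fourierCoeff (fun y => g i.1 y * F y) (r * i.2)‖ ^ 2 ≤
      r * M ^ 2 * ∫ y, ‖F y‖ ^ 2 ∂haarAddCircle := by
  have hj : ∀ j, ∑' n : ℤ, ‖fourierCoeff (fun y => g j y * F y) (r * n)‖ ^ 2 ≤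
      M ^ 2 * ∫ y, ‖F y‖ ^ 2 ∂haarAddCircle := fun j => by
    have hp := memLp_mul_of_bound (hgm j) (hgM j) hF
    have h := hasSum_sq_fourierCoeff_of_memLp hp
    have hinj : Function.Injective fun n : ℤ => (r : ℤ) * n := fun m n hmn => by
      have hr : (r : ℤ) ≠ 0 := by exact_mod_cast NeZero.ne r
      exact mul_left_cancel₀ hr hmn
    refine (tsum_comp_le_tsum_of_inj h.summable (fun _ => by positivity) hinj).trans ?_
    rw [h.tsum_eq, ← integral_const_mul]
    refine integral_mono_ae (hp.integrable_norm_pow (by norm_num))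
      ((hF.integrable_norm_pow (by norm_num)).const_mul _) ((hgM j).mono fun y hy => ?_)
    simp only [norm_mul, mul_pow]
    gcongr
  have h := hasSum_prod_of_fintype (κ := ℤ)
    (f := fun i : Fin r × ℤ => ‖fourierCoeff (fun y => g i.1 y * F y) (r * i.2)‖ ^ 2)
    fun j => (hasSum_sq_fourierCoeff_mul (r := r)
      (memLp_mul_of_bound (hgm j) (hgM j) hF)).summable.hasSum
  rw [h.tsum_eq]
  refine (Finset.sum_le_sum fun j _ => hj j).trans ?_
  simp [mul_assoc]

/-- A square summable sequence is the sequence of coefficients along `r ℤ` of a function invariant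
under the translations by `k / r`. -/
theorem exists_periodic_Lp [NeZero r] {y : ℤ → ℂ} (hy : Memℓp y 2) :
    ∃ Y : Lp ℂ 2 (haarAddCircle (T := (1 : ℝ))), (∀ n : ℤ, fourierCoeff Y (r * n) = y n) ∧
      (∀ m : ℤ, m ∉ Set.range (fun n : ℤ => (r : ℤ) * n) → fourierCoeff Y m = 0) ∧
      ∀ k : Fin r, ∀ᵐ t ∂haarAddCircle, Y (t + rootPoint r k) = Y t := by
  have hr : (r : ℤ) ≠ 0 := by exact_mod_cast NeZero.ne r
  have hinj : Function.Injective fun n : ℤ => (r : ℤ) * n := fun m n hmn =>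
    mul_left_cancel₀ hr hmn
  -- Placing `y` along `r ℤ` uses only characters that are invariant under translation by `k / r`.
  let z : ℤ → ℂ := fun m => if (r : ℤ) ∣ m then y (m / r) else 0
  have hzr : ∀ n, z (r * n) = y n := fun n => by
    simp [z, Int.mul_ediv_cancel_left n hr]
  have hz0 : ∀ m, m ∉ Set.range (fun n : ℤ => (r : ℤ) * n) → z m = 0 := fun m hm => by
    have : ¬ (r : ℤ) ∣ m := fun ⟨n, hn⟩ => hm ⟨n, hn.symm⟩
    simp [z, this]
  have hz : Memℓp z 2 := by
    refine memℓp_gen ?_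
    rw [← hinj.summable_iff]
    · refine (hy.summable (by norm_num)).congr fun n => ?_
      simp [hzr]
    · intro m hm
      simp [hz0 m hm]
  let Y : Lp ℂ 2 (haarAddCircle (T := (1 : ℝ))) := fourierBasis.repr.symm ⟨z, hz⟩
  have hYc : ∀ m, fourierCoeff Y m = z m := fun m => by
    rw [← fourierBasis_repr, LinearIsometryEquiv.apply_symm_apply]
  refine ⟨Y, fun n => by rw [hYc, hzr], fun m hm => by rw [hYc, hz0 m hm], fun k => ?_⟩
  have h1 := memLp_comp_add_right (Lp.memLp Y) (rootPoint r k)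
  have h2 : h1.toLp = Y := by
    apply fourierBasis.repr.injective
    ext m
    rw [fourierBasis_repr, fourierBasis_repr, fourierCoeff_congr_ae h1.coeFn_toLp,
      fourierCoeff_add_right, hYc]
    by_cases hm : (r : ℤ) ∣ m
    · rw [fourier_rootPoint_of_dvd hm, one_mul]
    · simp [z, hm]
  have h3 := h1.coeFn_toLp
  rw [h2] at h3
  exact h3.mono fun t ht => ht.symm

/-- Parseval's identity for the pairing with `Y`, whose spectrum in `r ℤ` removes all other
frequencies. -/
theorem hasSum_fourierCoeff_mul_inner [NeZero r] {y : ℤ → ℂ}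
    {Y : Lp ℂ 2 (haarAddCircle (T := (1 : ℝ)))}
    (hY : ∀ n : ℤ, fourierCoeff Y (r * n) = y n)
    (hY0 : ∀ m : ℤ, m ∉ Set.range (fun n : ℤ => (r : ℤ) * n) → fourierCoeff Y m = 0)
    {p : AddCircle (1 : ℝ) → ℂ} (hp : MemLp p 2 haarAddCircle) :
    HasSum (fun n : ℤ => fourierCoeff p (r * n) * (starRingEnd ℂ) (y n))
      (∫ t, p t * (starRingEnd ℂ) (Y t) ∂haarAddCircle) := by
  have hinj : Function.Injective fun n : ℤ => (r : ℤ) * n := fun m n hmn => by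
    have hr : (r : ℤ) ≠ 0 := by exact_mod_cast NeZero.ne r
    exact mul_left_cancel₀ hr hmn
  have h := fourierBasis.hasSum_inner_mul_inner Y hp.toLp
  have h1 : (inner ℂ Y hp.toLp : ℂ) = ∫ t, p t * (starRingEnd ℂ) (Y t) ∂haarAddCircle := by
    rw [L2.inner_def]
    refine integral_congr_ae ?_
    filter_upwards [hp.coeFn_toLp] with t ht
    simp only [RCLike.inner_apply, ht]
  have h3 : ∀ m : ℤ, (inner ℂ Y (fourierBasis (T := (1 : ℝ)) m) : ℂ) =
      (starRingEnd ℂ) (fourierCoeff Y m) := fun m => by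
    rw [← inner_conj_symm, ← fourierBasis.repr_apply_apply, fourierBasis_repr]
  rw [h1, ← hinj.hasSum_iff] at h
  · refine h.congr_fun fun n => ?_
    have h2 : (inner ℂ (fourierBasis (T := (1 : ℝ)) (r * n)) hp.toLp : ℂ) =
        fourierCoeff p (r * n) := by
      rw [← fourierBasis.repr_apply_apply, fourierBasis_repr, fourierCoeff_congr_ae hp.coeFn_toLp]
    simp only [Function.comp_apply]
    rw [h2, h3, hY, mul_comm]
  · intro m hm
    rw [h3, hY0 m hm, map_zero, zero_mul]

theorem isUnit_of_lower_bound {A : Matrix (Fin r) (Fin r) ℂ} {c : ℝ} (hc0 : 0 < c)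
    (hc : ∀ X : Fin r → ℂ, c * ∑ k, ‖X k‖ ^ 2 ≤ ∑ j, ‖A.mulVec X j‖ ^ 2) : IsUnit A := by
  rw [← Matrix.mulVec_injective_iff_isUnit, ← Matrix.coe_mulVecLin, ← LinearMap.ker_eq_bot,
    LinearMap.ker_eq_bot']
  intro X hX
  have h4 := hc X
  have h5 : A.mulVec X = 0 := hX
  rw [h5] at h4
  simp only [Pi.zero_apply, norm_zero, ne_eq, OfNat.ofNat_ne_zero, not_false_eq_true, zero_pow,
    Finset.sum_const_zero] at h4
  have h6 : ∑ k, ‖X k‖ ^ 2 = 0 :=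
    le_antisymm (by nlinarith) (Finset.sum_nonneg fun k _ => by positivity)
  rw [Finset.sum_eq_zero_iff_of_nonneg fun k _ => by positivity] at h6
  funext k
  simpa using h6 k (Finset.mem_univ k)

/-- The hypothesis `hY` says `A* Y = 0`. A square matrix bounded below is invertible, and so is its
adjoint; this is where having as many symbols as translates matters. -/
theorem eq_zero_of_sum_conj_mul {A : Matrix (Fin r) (Fin r) ℂ} {c : ℝ} (hc0 : 0 < c)
    (hc : ∀ X : Fin r → ℂ, c * ∑ k, ‖X k‖ ^ 2 ≤ ∑ j, ‖A.mulVec X j‖ ^ 2) {Y : Fin r → ℂ}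
    (hY : ∀ k, ∑ j, (starRingEnd ℂ) (A j k) * Y j = 0) (j : Fin r) : Y j = 0 := by
  have h7 : A.vecMul (fun j => (starRingEnd ℂ) (Y j)) = 0 := by
    funext k
    have h8 := congrArg (starRingEnd ℂ) (hY k)
    simp only [map_sum, map_mul, Complex.conj_conj, map_zero] at h8
    rw [Pi.zero_apply, ← h8]
    simp only [Matrix.vecMul, dotProduct]
    exact Finset.sum_congr rfl fun j _ => mul_comm _ _
  have h9 := Matrix.vecMul_injective_iff_isUnit.2 (isUnit_of_lower_bound hc0 hc)
    (h7.trans (Matrix.zero_vecMul _).symm)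
  simpa using congrFun h9 j

/-- Boundedness of the symbols puts the combination in `L²`, where `hY` makes it orthogonal to every
`F`. -/
theorem ae_sum_conj_mul_eq_zero
    (hgm : ∀ j, AEStronglyMeasurable (g j) haarAddCircle)
    (hgM : ∀ j, ∀ᵐ y ∂haarAddCircle, ‖g j y‖ ≤ M)
    (Y : Fin r → Lp ℂ 2 (haarAddCircle (T := (1 : ℝ))))
    (hY : ∀ F : Lp ℂ 2 (haarAddCircle (T := (1 : ℝ))),
      ∑ j, ∫ t, g j t * F t * (starRingEnd ℂ) (Y j t) ∂haarAddCircle = 0) :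
    ∀ᵐ t ∂haarAddCircle, ∑ j, (starRingEnd ℂ) (g j t) * Y j t = 0 := by
  have hYg : ∀ j, MemLp (fun t => (starRingEnd ℂ) (g j t) * Y j t) 2 haarAddCircle := fun j =>
    memLp_mul_of_bound (continuous_star.comp_aestronglyMeasurable (hgm j))
      ((hgM j).mono fun t ht => by simpa using ht) (Lp.memLp (Y j))
  have hW : MemLp (fun t => ∑ j, (starRingEnd ℂ) (g j t) * Y j t) 2 haarAddCircle :=
    memLp_finsetSum Finset.univ fun j _ => hYg j
  have hZ : hW.toLp = 0 := by
    refine ext_inner_right ℂ fun F => ?_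
    rw [inner_zero_left, ← hY F, ← integral_finsetSum, L2.inner_def]
    · refine integral_congr_ae (hW.coeFn_toLp.mono fun t ht => ?_)
      simp only [RCLike.inner_apply, ht, map_sum, map_mul, Complex.conj_conj, Finset.mul_sum]
      exact Finset.sum_congr rfl fun j _ => by ring
    · intro j _
      refine (L2.integrable_inner (𝕜 := ℂ) ((hYg j).toLp _) F).congr
        ((hYg j).coeFn_toLp.mono fun t ht => ?_)
      simp only [RCLike.inner_apply, ht, map_mul, Complex.conj_conj]
      ring
  have h1 := hW.coeFn_toLp
  rw [hZ] at h1
  filter_upwards [h1, Lp.coeFn_zero ℂ 2 haarAddCircle] with t ht1 ht3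
  rw [← ht1, ht3]
  rfl

theorem ae_add_right {P : AddCircle (1 : ℝ) → Prop} (h : ∀ᵐ t ∂haarAddCircle, P t)
    (s : AddCircle (1 : ℝ)) : ∀ᵐ t ∂haarAddCircle, P (t + s) :=
  (measurePreserving_add_right haarAddCircle s).quasiMeasurePreserving.ae h

/-- Periodic functions orthogonal to all products with the symbols vanish. -/
theorem ae_eq_zero_of_integral_symbol [NeZero r]
    (hgm : ∀ j, AEStronglyMeasurable (g j) haarAddCircle)
    (hgM : ∀ j, ∀ᵐ y ∂haarAddCircle, ‖g j y‖ ≤ M) {c : ℝ} (hc0 : 0 < c)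
    (hc : ∀ᵐ y ∂haarAddCircle, ∀ X : Fin r → ℂ,
      c * ∑ k, ‖X k‖ ^ 2 ≤ ∑ j, ‖(symbolMatrix g y).mulVec X j‖ ^ 2)
    (Y : Fin r → Lp ℂ 2 (haarAddCircle (T := (1 : ℝ))))
    (hYper : ∀ j (k : Fin r), ∀ᵐ t ∂haarAddCircle, Y j (t + rootPoint r k) = Y j t)
    (hY : ∀ F : Lp ℂ 2 (haarAddCircle (T := (1 : ℝ))),
      ∑ j, ∫ t, g j t * F t * (starRingEnd ℂ) (Y j t) ∂haarAddCircle = 0) :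
    ∀ᵐ t ∂haarAddCircle, ∀ j, Y j t = 0 := by
  have hae := ae_sum_conj_mul_eq_zero hgm hgM Y hY
  -- Evaluating at all translates while the `Y j` stay unchanged turns one scalar equation into the
  -- square system `G(t)* Y(t) = 0`.
  have hae2 : ∀ᵐ t ∂haarAddCircle, ∀ k : Fin r,
      ∑ j, (starRingEnd ℂ) (g j (t + rootPoint r k)) * Y j (t + rootPoint r k) = 0 :=
    ae_all_iff.2 fun k => ae_add_right
      (P := fun t => ∑ j, (starRingEnd ℂ) (g j t) * Y j t = 0) hae (rootPoint r k)
  have hYper2 : ∀ᵐ t ∂haarAddCircle, ∀ j (k : Fin r), Y j (t + rootPoint r k) = Y j t :=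
    ae_all_iff.2 fun j => ae_all_iff.2 fun k => hYper j k
  filter_upwards [hae2, hYper2, hc] with t h1 h2 h3
  intro j
  refine eq_zero_of_sum_conj_mul hc0 h3 (Y := fun j => Y j t) (fun k => ?_) j
  have h4 := h1 k
  simp only [h2] at h4
  exact h4

/-- An invertible symbol matrix leaves no nonzero sequence orthogonal to all decimated
coefficients. -/
theorem eq_zero_of_hasSum_symbol [NeZero r]
    (hgm : ∀ j, AEStronglyMeasurable (g j) haarAddCircle)
    (hgM : ∀ j, ∀ᵐ y ∂haarAddCircle, ‖g j y‖ ≤ M) {c : ℝ} (hc0 : 0 < c)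
    (hc : ∀ᵐ y ∂haarAddCircle, ∀ X : Fin r → ℂ,
      c * ∑ k, ‖X k‖ ^ 2 ≤ ∑ j, ‖(symbolMatrix g y).mulVec X j‖ ^ 2)
    (y : lp (fun _ : Fin r × ℤ => ℂ) 2)
    (hy : ∀ F : Lp ℂ 2 (haarAddCircle (T := (1 : ℝ))), HasSum (fun i : Fin r × ℤ =>
      fourierCoeff (fun t => g i.1 t * F t) (r * i.2) * (starRingEnd ℂ) (y i)) 0) : y = 0 := by
  have hmem : ∀ j, Memℓp (fun n : ℤ => y (j, n)) 2 := fun j =>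
    memℓp_gen (((lp.memℓp y).summable (by norm_num)).comp_injective (Prod.mk_right_injective j))
  choose Y hYc hY0 hYper using fun j => exists_periodic_Lp (r := r) (hmem j)
  have hYzero := ae_eq_zero_of_integral_symbol hgm hgM hc0 hc Y hYper fun F =>
    (hasSum_prod_of_fintype fun j => hasSum_fourierCoeff_mul_inner (hYc j) (hY0 j)
      (memLp_mul_of_bound (hgm j) (hgM j) (Lp.memLp F))).unique (hy F)
  ext ⟨j, n⟩
  have h10 : Y j = 0 := by
    refine Lp.ext ?_
    filter_upwards [hYzero, Lp.coeFn_zero ℂ 2 haarAddCircle] with t ht ht2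
    rw [ht j, ht2]
    rfl
  rw [← hYc j n, ← fourierBasis_repr, h10]
  simp

end Multiplier

/-! ### From energy bounds to pointwise bounds on the symbol matrix. -/

section Converse

open MeasureTheory AddCircle

variable {r : ℕ} {g : Fin r → AddCircle (1 : ℝ) → ℂ} {M : ℝ}

theorem symbolMatrix_mulVec_periodic [NeZero r] (F : AddCircle (1 : ℝ) → ℂ)
    (y : AddCircle (1 : ℝ)) (m j : Fin r) :
    (symbolMatrix g (y + rootPoint r m)).mulVec
        (fun k => F (y + rootPoint r m + rootPoint r k)) j =
      (symbolMatrix g y).mulVec (fun k => F (y + rootPoint r k)) j := by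
  rw [symbolMatrix_mulVec, symbolMatrix_mulVec F y]
  exact sum_rootPoint_add (fun z => g j z * F z) y m

/-- A lower bound for the decimated coefficients localizes to a pointwise bound. -/
theorem ae_lower_bound_of_function [NeZero r] (hgm : ∀ j, Measurable (g j))
    (hgM : ∀ j, ∀ᵐ y ∂haarAddCircle, ‖g j y‖ ≤ M) {C : ℝ} (hC : 0 < C)
    (h : ∀ F : AddCircle (1 : ℝ) → ℂ, MemLp F 2 haarAddCircle →
      ∫ y, ‖F y‖ ^ 2 ∂haarAddCircle ≤
        C * ∑' i : Fin r × ℤ, ‖fourierCoeff (fun y => g i.1 y * F y) (r * i.2)‖ ^ 2)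
    {F : AddCircle (1 : ℝ) → ℂ} (hFm : Measurable F) (hF : MemLp F 2 haarAddCircle) :
    ∀ᵐ y ∂haarAddCircle, r / C * ∑ k, ‖F (y + rootPoint r k)‖ ^ 2 ≤
      ∑ j, ‖(symbolMatrix g y).mulVec (fun k => F (y + rootPoint r k)) j‖ ^ 2 := by
  have hr : (0 : ℝ) < r := by exact_mod_cast NeZero.pos r
  have hga : ∀ j, AEStronglyMeasurable (g j) haarAddCircle := fun j => (hgm j).aestronglyMeasurable
  let A : AddCircle (1 : ℝ) → ℝ := fun y => ∑ k, ‖F (y + rootPoint r k)‖ ^ 2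
  let B : AddCircle (1 : ℝ) → ℝ := fun y =>
    ∑ j, ‖(symbolMatrix g y).mulVec (fun k => F (y + rootPoint r k)) j‖ ^ 2
  have hAm : Measurable A := by fun_prop
  have hBm : Measurable B := by
    simp only [B, symbolMatrix_mulVec]
    fun_prop
  have hAi : Integrable A haarAddCircle := integrable_finsetSum _ fun k _ =>
    (memLp_comp_add_right hF (rootPoint r k)).integrable_norm_pow (by norm_num)
  have hBi : Integrable B haarAddCircle := integrable_finsetSum _ fun j _ =>
    integrable_symbolMatrix_mulVec hga hgM hF j
  -- The set where the claim fails. It is invariant under the translations, so replacing `F` by its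
  -- restriction to `E` multiplies both `A` and `B` by the indicator of `E`.
  let E : Set (AddCircle (1 : ℝ)) := {y | B y < r / C * A y}
  have hE : MeasurableSet E := measurableSet_lt hBm (hAm.const_mul _)
  have hEper : ∀ y (k : Fin r), y + rootPoint r k ∈ E ↔ y ∈ E := fun y k => by
    have hA : A (y + rootPoint r k) = A y := sum_rootPoint_add (fun z => ‖F z‖ ^ 2) y k
    have hB : B (y + rootPoint r k) = B y :=
      Finset.sum_congr rfl fun j _ => by rw [symbolMatrix_mulVec_periodic]
    simp only [E, Set.mem_ofPred_eq, hA, hB]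
  have hFE : MemLp (E.indicator F) 2 haarAddCircle := hF.indicator hE
  have hind : ∀ y (k : Fin r), E.indicator F (y + rootPoint r k) =
      if y ∈ E then F (y + rootPoint r k) else 0 := fun y k => by
    simp only [Set.indicator_apply, hEper]
  have hAE : ∀ y, ∑ k, ‖E.indicator F (y + rootPoint r k)‖ ^ 2 = E.indicator A y := fun y => by
    simp only [hind]
    by_cases hy : y ∈ E <;> simp [hy, A]
  have hBE : ∀ y, ∑ j, ‖(symbolMatrix g y).mulVec
      (fun k => E.indicator F (y + rootPoint r k)) j‖ ^ 2 = E.indicator B y := fun y => by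
    simp only [hind]
    by_cases hy : y ∈ E
    · simp [hy, B]
    · have : (symbolMatrix g y).mulVec (fun _ => 0) = 0 := Matrix.mulVec_zero _
      simp [hy, this]
  have h1 := h _ hFE
  rw [(hasSum_sq_fourierCoeff_symbol hga hgM hFE).tsum_eq,
    integral_sq_eq_rootPoint (r := r) hFE] at h1
  simp only [hAE, hBE] at h1
  have h2 : r / C * ∫ y, E.indicator A y ∂haarAddCircle ≤ ∫ y, E.indicator B y ∂haarAddCircle := by
    rw [div_mul_eq_mul_div, div_le_iff₀ hC]
    have h3 := mul_le_mul_of_nonneg_left h1 (sq_nonneg (r : ℝ))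
    field_simp at h3
    linarith
  -- The integrand is strictly positive on `E`, so a nonpositive integral forces `E` to be null.
  have h4 : ∫ y, E.indicator (fun y => r / C * A y - B y) y ∂haarAddCircle ≤ 0 := by
    rw [integral_indicator hE, integral_sub (hAi.const_mul _).integrableOn hBi.integrableOn,
      integral_const_mul, ← integral_indicator hE, ← integral_indicator hE]
    linarith
  have hnn : ∀ y, 0 ≤ E.indicator (fun y => r / C * A y - B y) y := fun y =>
    Set.indicator_nonneg (fun z hz => sub_nonneg.2 (le_of_lt hz)) y
  have h5 := (integral_eq_zero_iff_of_nonneg (μ := haarAddCircle) hnn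
    (((hAi.const_mul (r / C)).sub hBi).indicator hE)).1
    (le_antisymm h4 (integral_nonneg hnn))
  filter_upwards [h5] with y hy
  by_contra hlt
  have hyE : y ∈ E := not_le.1 hlt
  simp only [Set.indicator_of_mem hyE, Pi.zero_apply] at hy
  have : B y < r / C * A y := hyE
  linarith

/-- The function on the circle equal to `v k` on `[k / r, (k + 1) / r)`. -/
noncomputable def stepFun [NeZero r] (v : Fin r → ℂ) (y : AddCircle (1 : ℝ)) : ℂ :=
  v (Fin.ofNat r ⌊(r : ℝ) * (measurableEquivIco (1 : ℝ) 0 y : ℝ)⌋₊)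

theorem measurable_stepFun [NeZero r] (v : Fin r → ℂ) : Measurable (stepFun v) := by
  have h1 : Measurable fun y : AddCircle (1 : ℝ) =>
      ⌊(r : ℝ) * (measurableEquivIco (1 : ℝ) 0 y : ℝ)⌋₊ :=
    Nat.measurable_floor.comp (((measurable_subtype_coe).comp
      (measurableEquivIco (1 : ℝ) 0).measurable).const_mul _)
  exact (measurable_from_nat (f := fun n => v (Fin.ofNat r n))).comp h1

theorem memLp_stepFun [NeZero r] (v : Fin r → ℂ) : MemLp (stepFun v) 2 haarAddCircle :=
  MemLp.of_bound (measurable_stepFun v).aestronglyMeasurable (∑ k, ‖v k‖)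
    (Filter.Eventually.of_forall fun _ =>
      Finset.single_le_sum (f := fun k => ‖v k‖) (fun _ _ => norm_nonneg _) (Finset.mem_univ _))

theorem stepFun_apply [NeZero r] (v : Fin r → ℂ) {x : ℝ}
    (hx : x ∈ Set.Ioo (0 : ℝ) (1 / (r : ℝ))) (k : Fin r) :
    stepFun v ((x : AddCircle (1 : ℝ)) + rootPoint r k) = v k := by
  have hr : (0 : ℝ) < r := by exact_mod_cast NeZero.pos r
  have hk : ((k : ℕ) : ℝ) + 1 ≤ r := by exact_mod_cast k.2
  have hx2 : x * r < 1 := by rw [← lt_div_iff₀ hr]; exact hx.2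
  have hmem : x + ((k : ℕ) : ℝ) / r ∈ Set.Ico (0 : ℝ) (0 + 1) := by
    refine ⟨by have := hx.1; positivity, ?_⟩
    have : x + ((k : ℕ) : ℝ) / r = (x * r + (k : ℕ)) / r := by field_simp
    rw [zero_add, this, div_lt_one hr]
    linarith
  have h1 : (measurableEquivIco (1 : ℝ) 0 ((x : AddCircle (1 : ℝ)) + rootPoint r k) : ℝ) =
      x + ((k : ℕ) : ℝ) / r := by
    rw [rootPoint, ← AddCircle.coe_add]
    exact equivIco_coe_of_mem (p := (1 : ℝ)) (a := 0) hmem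
  have h2 : ⌊(r : ℝ) * (x + ((k : ℕ) : ℝ) / r)⌋₊ = k := by
    have h3 : (r : ℝ) * (x + ((k : ℕ) : ℝ) / r) = x * r + ((k : ℕ) : ℝ) := by field_simp
    rw [h3, Nat.floor_add_natCast (mul_nonneg hx.1.le hr.le), Nat.floor_eq_zero.2 hx2, zero_add]
  rw [stepFun, h1, h2]
  congr 1
  ext
  simp

/-- A lower bound for the decimated coefficients bounds the symbol matrix from below. -/
theorem ae_lower_bound [NeZero r] (hgm : ∀ j, Measurable (g j))
    (hgM : ∀ j, ∀ᵐ y ∂haarAddCircle, ‖g j y‖ ≤ M) {C : ℝ} (hC : 0 < C)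
    (h : ∀ F : AddCircle (1 : ℝ) → ℂ, MemLp F 2 haarAddCircle →
      ∫ y, ‖F y‖ ^ 2 ∂haarAddCircle ≤
        C * ∑' i : Fin r × ℤ, ‖fourierCoeff (fun y => g i.1 y * F y) (r * i.2)‖ ^ 2) :
    ∀ᵐ x : ℝ ∂volume.restrict (Set.Ioo (0 : ℝ) (1 / (r : ℝ))), ∀ X : Fin r → ℂ,
      r / C * ∑ k, ‖X k‖ ^ 2 ≤ ∑ j, ‖(symbolMatrix g x).mulVec X j‖ ^ 2 := by
  -- The exceptional null set depends on `X`; a countable dense set of vectors gives a common one,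
  -- and both sides are continuous in `X`.
  obtain ⟨s, hs, hsd⟩ := TopologicalSpace.exists_countable_dense (Fin r → ℂ)
  have hr1 : 1 / (r : ℝ) ≤ 1 := by
    rw [div_le_one (by exact_mod_cast NeZero.pos r)]
    exact_mod_cast NeZero.one_le
  have h1 : ∀ᵐ x : ℝ ∂volume.restrict (Set.Ioo (0 : ℝ) (1 / (r : ℝ))), ∀ X ∈ s,
      r / C * ∑ k, ‖X k‖ ^ 2 ≤ ∑ j, ‖(symbolMatrix g x).mulVec X j‖ ^ 2 := by
    rw [ae_ball_iff hs]
    intro X _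
    -- For `x` in `(0, 1 / r)` the translates of `stepFun X` reproduce the prescribed vector `X`.
    have h2 := ae_Ioo_of_ae_circle hr1
      (ae_lower_bound_of_function hgm hgM hC h (measurable_stepFun X) (memLp_stepFun X))
    filter_upwards [h2, ae_restrict_mem measurableSet_Ioo] with x hx hmem
    simpa only [stepFun_apply X hmem] using hx
  filter_upwards [h1] with x hx X
  have hclosed : IsClosed {X : Fin r → ℂ |
      r / C * ∑ k, ‖X k‖ ^ 2 ≤ ∑ j, ‖(symbolMatrix g x).mulVec X j‖ ^ 2} := by
    refine isClosed_le (by fun_prop) ?_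
    simp only [Matrix.mulVec, dotProduct]
    fun_prop
  exact hclosed.closure_subset_iff.2 hx (hsd X)

end Converse

/-! ### Dual vectors in the infinite factor. -/

section ShiftDual

open MeasureTheory AddCircle

variable {H₁ : Type*} [NormedAddCommGroup H₁] [InnerProductSpace ℂ H₁]
  {U : H₁ ≃ₗᵢ[ℂ] H₁} {a : H₁} {r : ℕ} {h : Fin r → H₁}

theorem gMatrix_eq_symbolMatrix (x : ℝ) :
    gMatrix U a h r x = symbolMatrix (fun j => gL2 U a (h j)) (x : AddCircle (1 : ℝ)) := by
  ext j k
  simp [gMatrix, symbolMatrix, gFun, rootPoint]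

theorem measurable_gL2 (h : H₁) : Measurable (gL2 U a h) :=
  (Lp.stronglyMeasurable _).measurable

theorem exists_lower_bound_of_alphaG_pos [NeZero r] (hα : 0 < alphaG U a h r) :
    ∃ c : ℝ, 0 < c ∧ ∀ᵐ y ∂haarAddCircle, ∀ X : Fin r → ℂ, c * ∑ k, ‖X k‖ ^ 2 ≤
      ∑ j, ‖(symbolMatrix (fun j => gL2 U a (h j)) y).mulVec X j‖ ^ 2 := by
  obtain ⟨c, hc0, hc⟩ := EReal.lt_iff_exists_real_btwn.1 hα
  refine ⟨c, by exact_mod_cast hc0, ae_circle_of_ae_Ioo_div (r := r) (fun y m hy X => ?_) ?_⟩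
  · have h1 := hy (fun k => X (k - m))
    have h2 : ∑ k, ‖X (k - m)‖ ^ 2 = ∑ k, ‖X k‖ ^ 2 :=
      (Equiv.sum_comp (Equiv.subRight m) fun k => ‖X k‖ ^ 2)
    rw [h2] at h1
    refine h1.trans_eq (Finset.sum_congr rfl fun j _ => ?_)
    congr 2
    simp only [Matrix.mulVec, dotProduct, symbolMatrix, Matrix.of_apply]
    rw [← Equiv.sum_comp (Equiv.addRight m)]
    refine Finset.sum_congr rfl fun k _ => ?_
    simp [rootPoint_add, add_assoc, add_comm]
  · have h1 := ae_essInf_le (f := fun x : ℝ => (lambdaMin (gMatrix U a h r x) : EReal))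
      (μ := volume.restrict (Set.Ioo (0 : ℝ) (1 / (r : ℝ))))
    filter_upwards [h1] with x hx X
    have h2 : c ≤ lambdaMin (gMatrix U a h r x) := by
      exact_mod_cast hc.le.trans hx
    rw [← gMatrix_eq_symbolMatrix]
    exact (le_lambdaMin_iff (NeZero.pos r) _ _).1 h2 X

theorem alphaG_pos_of_lower_bound [NeZero r] {c : ℝ} (hc0 : 0 < c)
    (hc : ∀ᵐ x : ℝ ∂volume.restrict (Set.Ioo (0 : ℝ) (1 / (r : ℝ))), ∀ X : Fin r → ℂ,
      c * ∑ k, ‖X k‖ ^ 2 ≤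
        ∑ j, ‖(symbolMatrix (fun j => gL2 U a (h j)) x).mulVec X j‖ ^ 2) :
    0 < alphaG U a h r := by
  have h1 : (0 : EReal) < (c : EReal) := by exact_mod_cast hc0
  refine h1.trans_le (le_essInf_of_ae_le _ (hc.mono fun x hx => ?_))
  have h2 := (le_lambdaMin_iff (NeZero.pos r) (gMatrix U a h r x) c).2
    (by rw [gMatrix_eq_symbolMatrix]; exact hx)
  exact EReal.coe_le_coe_iff.2 h2

/-- When the symbol matrix is bounded below, there are dual vectors whose shifts form a Riesz
basis. -/
theorem exists_shift_dual [CompleteSpace H₁] [NeZero r]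
    (ha : IsRieszSequence fun n : ℤ => (U ^ n) a)
    (hg : ∀ j, MemLp (gFun U a (h j)) ∞ (volume.restrict (Set.Ioo (0 : ℝ) 1)))
    (hα : 0 < alphaG U a h r) :
    ∃ c : Fin r → H₁,
      IsRieszBasisOf (Submodule.span ℂ (Set.range fun n : ℤ => (U ^ n) a)).topologicalClosure
        (fun i : Fin r × ℤ => (U ^ ((r : ℤ) * i.2)) (c i.1)) ∧
      ∀ i k : Fin r × ℤ, inner ℂ ((U ^ ((r : ℤ) * i.2)) (h i.1))
        ((U ^ ((r : ℤ) * k.2)) (c k.1)) = if k = i then (1 : ℂ) else 0 := by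
  set K := (Submodule.span ℂ (Set.range fun n : ℤ => (U ^ n) a)).topologicalClosure
  obtain ⟨Φ, hΦ⟩ : ∃ Φ : Lp ℂ 2 (haarAddCircle (T := (1 : ℝ))) ≃L[ℂ] K,
    ∀ n : ℤ, (Φ (fourierLp 2 n) : H₁) = (U ^ n) a := ha.exists_circle_equiv
  obtain ⟨c₀, hc₀, hc⟩ := exists_lower_bound_of_alphaG_pos hα
  obtain ⟨M, hM0, hM⟩ := exists_ae_norm_gL2_le hg
  have hgm : ∀ j, AEStronglyMeasurable (gL2 U a (h j)) haarAddCircle :=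
    fun j => Lp.aestronglyMeasurable _
  have hr : (0 : ℝ) < r := by exact_mod_cast NeZero.pos r
  let Φ' : Lp ℂ 2 (haarAddCircle (T := (1 : ℝ))) →L[ℂ] H₁ :=
    K.subtypeL.comp (Φ : Lp ℂ 2 (haarAddCircle (T := (1 : ℝ))) →L[ℂ] K)
  let ψ : Fin r × ℤ → Lp ℂ 2 (haarAddCircle (T := (1 : ℝ))) := fun i =>
    ContinuousLinearMap.adjoint Φ' ((U ^ ((r : ℤ) * i.2)) (h i.1))
  have hψ : ∀ i F, inner ℂ (ψ i) F =
      (inner ℂ ((U ^ ((r : ℤ) * i.2)) (h i.1)) (Φ F : H₁) : ℂ) := fun i F =>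
    ContinuousLinearMap.adjoint_inner_left _ _ _
  have hψc : ∀ i F, inner ℂ (ψ i) F =
      fourierCoeff (fun y => gL2 U a (h i.1) y * F y) (r * i.2) := fun i F => by
    rw [hψ]
    exact inner_zpow_eq_fourierCoeff Φ' hΦ (h i.1) (r * i.2) F
  obtain ⟨L, hL⟩ := exists_analysis_equiv ψ (A := (r : ℝ)⁻¹ * c₀) (B := r * M ^ 2)
    (by positivity)
    (fun F => by
      simp only [hψc]
      exact (hasSum_sq_fourierCoeff_symbol hgm hM (Lp.memLp F)).summable)
    (fun F => by
      simp only [hψc, norm_sq_eq_integral F]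
      exact symbol_lower_bound hgm hM hc (Lp.memLp F))
    (fun F => by
      simp only [hψc, norm_sq_eq_integral F]
      exact symbol_upper_bound hgm hM (Lp.memLp F))
    (fun y hy => by
      simp only [hψc] at hy
      exact eq_zero_of_hasSum_symbol hgm hM hc₀ hc y hy)
  let Λ : K ≃L[ℂ] lp (fun _ : Fin r × ℤ => ℂ) 2 := Φ.symm.trans L
  have hΛ : ∀ (u : K) i, Λ u i = inner ℂ ((U ^ ((r : ℤ) * i.2)) (h i.1)) (u : H₁) := fun u i => by
    have : Λ u i = L (Φ.symm u) i := rfl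
    rw [this, hL, hψ, Φ.apply_symm_apply]
  -- The dual vector is the preimage of the unit sequence at `(j, 0)`; unitarity of `U` then gives
  -- biorthogonality of all shifts.
  let c : Fin r → H₁ := fun j => (Λ.symm (lp.single 2 (j, 0) 1) : K)
  have hcK : ∀ i : Fin r × ℤ, (U ^ ((r : ℤ) * i.2)) (c i.1) ∈ K := fun i =>
    zpow_mem_closure_span U a _ (Λ.symm (lp.single 2 (i.1, 0) 1)).2
  have hbi : ∀ i k : Fin r × ℤ, inner ℂ ((U ^ ((r : ℤ) * i.2)) (h i.1))
        ((U ^ ((r : ℤ) * k.2)) (c k.1)) = if k = i then (1 : ℂ) else 0 := by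
    rintro ⟨i, m⟩ ⟨k, n⟩
    rw [inner_zpow_zpow, ← mul_sub, ← hΛ _ (i, m - n), Λ.apply_symm_apply, lp.single_apply,
      Pi.single_apply]
    simp only [Prod.mk.injEq, sub_eq_zero]
    exact if_congr (and_congr eq_comm eq_comm) rfl rfl
  refine ⟨c, ?_, hbi⟩
  -- Only a Hilbert basis of `K` indexed by `ℤ` is needed here; it is relabelled by `Fin r × ℤ`,
  -- also countably infinite.
  obtain ⟨e, -, -⟩ := ha
  have σ : ℤ ≃ Fin r × ℤ := by
    have : Infinite (Fin r × ℤ) := Prod.infinite_of_right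
    exact nonempty_equiv_of_countable.some
  refine isRieszBasisOf_of_equiv (reindexHilbertBasis e σ) Λ.symm fun i => ?_
  have h1 : Λ ⟨_, hcK i⟩ = lp.single 2 i 1 := by
    ext k
    rw [hΛ, hbi, lp.single_apply, Pi.single_apply]
    exact if_congr eq_comm rfl rfl
  rw [← h1, Λ.symm_apply_apply]

end ShiftDual

/-! ### Assembly on the tensor product, interpolation and uniqueness. -/

section Main

open MeasureTheory AddCircle

variable {H₁ H₂ : Type*} [NormedAddCommGroup H₁] [InnerProductSpace ℂ H₁]
  [NormedAddCommGroup H₂] [InnerProductSpace ℂ H₂]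
  {U : H₁ ≃ₗᵢ[ℂ] H₁} {V : H₂ ≃ₗᵢ[ℂ] H₂} {a : H₁} {b : H₂} {N r r' ℓ : ℕ}
  {h₁ : Fin r → H₁} {h₂ : Fin r' → H₂}

/-- Generators may be replaced by closed spans in each factor, and the cyclic span is already closed
because it is finite-dimensional. -/
theorem invSubspace_eq_tensorSubspace : invSubspace U V a b N =
    tensorSubspace (Submodule.span ℂ (Set.range fun n : ℤ => (U ^ n) a)).topologicalClosure
      (cyclicSpan V b N) := by
  have h : (cyclicSpan V b N).topologicalClosure = cyclicSpan V b N :=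
    IsClosed.submodule_topologicalClosure_eq (Submodule.closed_of_finiteDimensional _)
  rw [← h, cyclicSpan, tensorSubspace_closure_span]
  rfl

theorem sample_htmul (g₁ : H₁) (g₂ : H₂) (u : H₁) (v : H₂) (k q : ℤ) :
    sample U V g₁ g₂ (htmul u v) k q = inner ℂ ((U ^ k) g₁) u * inner ℂ ((V ^ q) g₂) v :=
  inner_htmul _ _ _ _

/-- Regrouping of the indices of the two factors. -/
def indexEquiv (r r' ℓ : ℕ) :
    (Fin r × ℤ) × (Fin r' × Fin ℓ) ≃ Fin r × Fin r' × ℤ × Fin ℓ where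
  toFun x := (x.1.1, x.2.1, x.1.2, x.2.2)
  invFun x := ((x.1, x.2.2.1), (x.2.1, x.2.2.2))
  left_inv _ := rfl
  right_inv _ := rfl

/-- The vector `w j j'` is itself the basis vector of index `(j, j', 0, 0)`, so its coefficients
form a unit sequence; by the expansion they are also its samples. -/
theorem IsSamplingRieszBasis.interpolation (hℓ : 0 < ℓ) {w : Fin r → Fin r' → HTensor H₁ H₂}
    (hw : IsSamplingRieszBasis U V a b N r r' ℓ h₁ h₂ w) (j k : Fin r) (j' k' : Fin r') (n : ℤ)
    (m : Fin ℓ) :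
    sample U V (h₁ k) (h₂ k') (w j j') ((r : ℤ) * n) ((r' : ℤ) * ((m : ℕ) : ℤ)) =
      if j = k ∧ j' = k' ∧ n = 0 ∧ (m : ℕ) = 0 then 1 else 0 := by
  classical
  obtain ⟨L, hL⟩ := hw.rieszBasis.exists_equiv
  obtain ⟨c, d, hcd⟩ := hw.exists_eq_tmul
  have h1 := hL (j, j', 0, ⟨0, hℓ⟩)
  simp only [hcd, shiftOp_htmul, mul_zero, Nat.cast_zero, zpow_zero] at h1
  have h2 : (⟨w j j', hw.mem j j'⟩ : invSubspace U V a b N) =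
      L (lp.single 2 (j, j', 0, ⟨0, hℓ⟩) 1) := by
    refine Subtype.ext ?_
    rw [← h1]
    exact hcd j j'
  have h3 := coeff_eq_of_equiv L hL (x := ⟨w j j', hw.mem j j'⟩)
    (hw.expansion _ (hw.mem j j')) (k, k', n, m)
  rw [← h3, h2, L.symm_apply_apply, lp.single_apply, Pi.single_apply]
  refine if_congr ?_ rfl rfl
  simp only [Prod.mk.injEq, Fin.ext_iff]
  exact and_congr eq_comm (and_congr eq_comm Iff.rfl)

/-- By interpolation `w j j'` and `w' j j'` have the same samples, so both are the sum of the same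
series in the shifts of `w`. -/
theorem IsSamplingRieszBasis.unique (hℓ : 0 < ℓ) {w w' : Fin r → Fin r' → HTensor H₁ H₂}
    (hw : IsSamplingRieszBasis U V a b N r r' ℓ h₁ h₂ w)
    (hw' : IsSamplingRieszBasis U V a b N r r' ℓ h₁ h₂ w') : w' = w := by
  funext j j'
  have h1 := hw.expansion _ (hw.mem j j')
  have h2 := hw.expansion _ (hw'.mem j j')
  simp only [hw.interpolation hℓ] at h1
  simp only [hw'.interpolation hℓ] at h2
  exact h2.unique h1

/-- Dual vectors in both factors give a sampling Riesz basis. -/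
theorem isSamplingRieszBasis_htmul [CompleteSpace H₁] {c : Fin r → H₁} {d : Fin r' → H₂}
    (hℓ : 0 < ℓ)
    (hc : IsRieszBasisOf (Submodule.span ℂ (Set.range fun n : ℤ => (U ^ n) a)).topologicalClosure
        (fun i : Fin r × ℤ => (U ^ ((r : ℤ) * i.2)) (c i.1)))
    (hcb : ∀ i k : Fin r × ℤ, inner ℂ ((U ^ ((r : ℤ) * i.2)) (h₁ i.1))
        ((U ^ ((r : ℤ) * k.2)) (c k.1)) = if k = i then (1 : ℂ) else 0)
    (hd : IsRieszBasisOf (cyclicSpan V b N)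
        (fun i : Fin r' × Fin ℓ => (V ^ ((r' : ℤ) * ((i.2 : ℕ) : ℤ))) (d i.1)))
    (hdb : ∀ i k : Fin r' × Fin ℓ, inner ℂ ((V ^ ((r' : ℤ) * ((i.2 : ℕ) : ℤ))) (h₂ i.1))
        ((V ^ ((r' : ℤ) * ((k.2 : ℕ) : ℤ))) (d k.1)) = if k = i then (1 : ℂ) else 0) :
    IsSamplingRieszBasis U V a b N r r' ℓ h₁ h₂ fun j j' => htmul (c j) (d j') := by
  have hclosed : IsClosed (invSubspace U V a b N : Set (HTensor H₁ H₂)) :=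
    Submodule.isClosed_topologicalClosure _
  have : CompleteSpace (invSubspace U V a b N) := hclosed.completeSpace_coe
  have hR : IsRieszBasisOf (invSubspace U V a b N)
      fun i : Fin r × Fin r' × ℤ × Fin ℓ =>
        shiftOp U V ((r : ℤ) * i.2.2.1) ((r' : ℤ) * ((i.2.2.2 : ℕ) : ℤ))
          (htmul (c i.1) (d i.2.1)) := by
    have h1 := hc.htmul hd
    rw [← invSubspace_eq_tensorSubspace] at h1
    simp only [shiftOp_htmul]
    exact h1.reindex (indexEquiv r r' ℓ)
  refine ⟨⟨c, d, fun _ _ => rfl⟩, fun j j' => ?_, hR, fun x hx => ?_⟩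
  · simpa [shiftOp_htmul] using mem_of_isRieszBasisOf hR (j, j', 0, ⟨0, hℓ⟩)
  · refine hR.hasSum_of_biorthogonal (w := fun i : Fin r × Fin r' × ℤ × Fin ℓ =>
      htmul ((U ^ ((r : ℤ) * i.2.2.1)) (h₁ i.1))
        ((V ^ ((r' : ℤ) * ((i.2.2.2 : ℕ) : ℤ))) (h₂ i.2.1))) ?_ hx
    rintro ⟨i, i', n, m⟩ ⟨k, k', n', m'⟩
    rw [shiftOp_htmul, inner_htmul]
    have h1 := hcb (i, n) (k, n')
    have h2 := hdb (i', m) (k', m')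
    simp only at h1 h2 ⊢
    rw [h1, h2, ite_zero_mul_ite_zero, one_mul]
    refine if_congr ?_ rfl rfl
    simp only [Prod.mk.injEq]
    tauto

theorem tsum_indexEquiv {α : Fin r × ℤ → ℝ} {β : Fin r' × Fin ℓ → ℝ} (hα : Summable α)
    (hs : Summable fun i : Fin r × Fin r' × ℤ × Fin ℓ => α (i.1, i.2.2.1) * β (i.2.1, i.2.2.2)) :
    ∑' i : Fin r × Fin r' × ℤ × Fin ℓ, α (i.1, i.2.2.1) * β (i.2.1, i.2.2.2) =
      (∑' i, α i) * ∑ i, β i := by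
  rw [← (indexEquiv r r' ℓ).tsum_eq]
  rw [← (indexEquiv r r' ℓ).summable_iff] at hs
  exact (hα.hasSum.mul (hasSum_fintype β) hs).tsum_eq

/-- A sampling Riesz basis gives a lower bound for the samples of elementary tensors. -/
theorem IsSamplingRieszBasis.exists_lower_bound {w : Fin r → Fin r' → HTensor H₁ H₂}
    (hw : IsSamplingRieszBasis U V a b N r r' ℓ h₁ h₂ w) :
    ∃ C : ℝ, 0 < C ∧
      ∀ u ∈ (Submodule.span ℂ (Set.range fun n : ℤ => (U ^ n) a)).topologicalClosure,
      Summable (fun i : Fin r × ℤ => ‖(inner ℂ ((U ^ ((r : ℤ) * i.2)) (h₁ i.1)) u : ℂ)‖ ^ 2) →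
      ∀ v ∈ cyclicSpan V b N, ‖u‖ ^ 2 * ‖v‖ ^ 2 ≤
        C * ((∑' i : Fin r × ℤ, ‖(inner ℂ ((U ^ ((r : ℤ) * i.2)) (h₁ i.1)) u : ℂ)‖ ^ 2) *
          ∑ i : Fin r' × Fin ℓ,
            ‖(inner ℂ ((V ^ ((r' : ℤ) * ((i.2 : ℕ) : ℤ))) (h₂ i.1)) v : ℂ)‖ ^ 2) := by
  obtain ⟨C, hC, hbound⟩ := hw.rieszBasis.exists_norm_sq_le
  refine ⟨C, hC, fun u hu hsu v hv => ?_⟩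
  have hmem : htmul u v ∈ invSubspace U V a b N := by
    rw [invSubspace_eq_tensorSubspace]
    exact htmul_mem_tensorSubspace hu hv
  obtain ⟨hs, hle⟩ := hbound _ hmem _ (hw.expansion _ hmem)
  have hterm : ∀ i : Fin r × Fin r' × ℤ × Fin ℓ,
      ‖sample U V (h₁ i.1) (h₂ i.2.1) (htmul u v) ((r : ℤ) * i.2.2.1)
        ((r' : ℤ) * ((i.2.2.2 : ℕ) : ℤ))‖ ^ 2 =
      ‖(inner ℂ ((U ^ ((r : ℤ) * i.2.2.1)) (h₁ i.1)) u : ℂ)‖ ^ 2 *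
        ‖(inner ℂ ((V ^ ((r' : ℤ) * ((i.2.2.2 : ℕ) : ℤ))) (h₂ i.2.1)) v : ℂ)‖ ^ 2 := fun i => by
    rw [sample_htmul, norm_mul, mul_pow]
  rw [norm_htmul, mul_pow, tsum_congr hterm] at hle
  rw [funext hterm] at hs
  rw [tsum_indexEquiv hsu
    (β := fun i => ‖(inner ℂ ((V ^ ((r' : ℤ) * ((i.2 : ℕ) : ℤ))) (h₂ i.1)) v : ℂ)‖ ^ 2) hs] at hle
  exact hle

end Main

end TensorSampling

theorem mainTheorem2
    {H₁ H₂ : Type*}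
    [NormedAddCommGroup H₁] [InnerProductSpace ℂ H₁] [CompleteSpace H₁]
    [TopologicalSpace.SeparableSpace H₁]
    [NormedAddCommGroup H₂] [InnerProductSpace ℂ H₂] [CompleteSpace H₂]
    [TopologicalSpace.SeparableSpace H₂]
    (U : H₁ ≃ₗᵢ[ℂ] H₁) (V : H₂ ≃ₗᵢ[ℂ] H₂) (a : H₁) (b : H₂)
    (ha : TensorSampling.IsRieszSequence fun n : ℤ => (U ^ n) a)
    (N : ℕ) (hN : 0 < N) (hVb : (V ^ N) b = b)
    (hb : LinearIndependent ℂ fun p : Fin N => (V ^ (p : ℕ)) b)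
    (r r' ℓ : ℕ) (hr : 0 < r) (hℓ : r' * ℓ = N)
    (h₁ : Fin r → H₁) (h₂ : Fin r' → H₂)
    (hg : ∀ j, MeasureTheory.MemLp (TensorSampling.gFun U a (h₁ j)) ∞
      (MeasureTheory.volume.restrict (Set.Ioo (0 : ℝ) 1))) :
    ((0 < TensorSampling.alphaG U a h₁ r ∧
        IsUnit (Matrix.reindex (finCongr hℓ) (Equiv.refl (Fin N))
          (TensorSampling.crossCovMatrix V b h₂ r' ℓ N))) ↔
      ∃! w : Fin r → Fin r' → TensorSampling.HTensor H₁ H₂,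
        TensorSampling.IsSamplingRieszBasis U V a b N r r' ℓ h₁ h₂ w) ∧
    ∀ w : Fin r → Fin r' → TensorSampling.HTensor H₁ H₂,
      TensorSampling.IsSamplingRieszBasis U V a b N r r' ℓ h₁ h₂ w →
      ∀ (j k : Fin r) (j' k' : Fin r') (n : ℤ) (m : Fin ℓ),
        TensorSampling.sample U V (h₁ k) (h₂ k') (w j j') ((r : ℤ) * n)
            ((r' : ℤ) * ((m : ℕ) : ℤ)) =
          if j = k ∧ j' = k' ∧ n = 0 ∧ (m : ℕ) = 0 then 1 else 0 := by
  open TensorSampling MeasureTheory AddCircle in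
  have : NeZero r := ⟨hr.ne'⟩
  have hℓ0 : 0 < ℓ := by
    rcases Nat.eq_zero_or_pos ℓ with h | h
    · subst h; omega
    · exact h
  refine ⟨⟨?_, ?_⟩, fun w hw j k j' k' n m => hw.interpolation hℓ0 j k j' k' n m⟩
  · rintro ⟨hα, hR⟩
    obtain ⟨c, hc, hcb⟩ := exists_shift_dual ha hg hα
    obtain ⟨d, hd, hdb⟩ := exists_cyclic_dual hN hVb hb hℓ h₂ hR
    exact ⟨_, isSamplingRieszBasis_htmul hℓ0 hc hcb hd hdb,
      fun w' hw' => (isSamplingRieszBasis_htmul hℓ0 hc hcb hd hdb).unique hℓ0 hw'⟩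
  · rintro ⟨w, hw, -⟩
    obtain ⟨C, hC, hlow⟩ := hw.exists_lower_bound
    set K := (Submodule.span ℂ (Set.range fun n : ℤ => (U ^ n) a)).topologicalClosure
    obtain ⟨Φ, hΦ⟩ : ∃ Φ : Lp ℂ 2 (haarAddCircle (T := (1 : ℝ))) ≃L[ℂ] K,
      ∀ n : ℤ, (Φ (fourierLp 2 n) : H₁) = (U ^ n) a := ha.exists_circle_equiv
    obtain ⟨M, hM0, hM⟩ := exists_ae_norm_gL2_le hg
    have hgm : ∀ j, AEStronglyMeasurable (gL2 U a (h₁ j)) haarAddCircle :=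
      fun j => Lp.aestronglyMeasurable _
    have hcoef : ∀ (i : Fin r × ℤ) F,
        (inner ℂ ((U ^ ((r : ℤ) * i.2)) (h₁ i.1)) (Φ F : H₁) : ℂ) =
          fourierCoeff (fun y => gL2 U a (h₁ i.1) y * F y) (r * i.2) := fun i F =>
      inner_zpow_eq_fourierCoeff (K.subtypeL.comp
        (Φ : Lp ℂ 2 (haarAddCircle (T := (1 : ℝ))) →L[ℂ] K)) hΦ (h₁ i.1) (r * i.2) F
    have hlow' : ∀ F, ∀ v ∈ cyclicSpan V b N, ‖Φ F‖ ^ 2 * ‖v‖ ^ 2 ≤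
        C * ((∑' i : Fin r × ℤ,
          ‖fourierCoeff (fun y => gL2 U a (h₁ i.1) y * F y) (r * i.2)‖ ^ 2) *
          ∑ i : Fin r' × Fin ℓ,
            ‖(inner ℂ ((V ^ ((r' : ℤ) * ((i.2 : ℕ) : ℤ))) (h₂ i.1)) v : ℂ)‖ ^ 2) := by
      intro F v hv
      have h1 := hlow (Φ F) (Φ F).2
      simp only [hcoef] at h1
      exact h1 (hasSum_sq_fourierCoeff_symbol hgm hM (Lp.memLp F)).summable v hv
    constructor
    -- Freezing the second vector at `b ≠ 0` leaves a lower bound for the symbols alone.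
    · have hb0 : 0 < ‖b‖ := by
        have := hb.ne_zero ⟨0, hN⟩
        simpa using this
      have hbK : b ∈ cyclicSpan V b N := by
        simpa using zpow_apply_mem_cyclicSpan hN hVb 0
      set β := ∑ i : Fin r' × Fin ℓ,
            ‖(inner ℂ ((V ^ ((r' : ℤ) * ((i.2 : ℕ) : ℤ))) (h₂ i.1)) b : ℂ)‖ ^ 2 with hβ
      have hβ0 : 0 ≤ β := Finset.sum_nonneg fun _ _ => by positivity
      set κ := ‖(Φ.symm : K →L[ℂ] Lp ℂ 2 (haarAddCircle (T := (1 : ℝ))))‖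
      -- The factor `κ ^ 2` undoes `Φ`; the `+ 1` secures positivity without first excluding `β =
      -- 0`.
      have hC' : 0 < κ ^ 2 * (C * β / ‖b‖ ^ 2) + 1 := by positivity
      refine alphaG_pos_of_lower_bound (div_pos (Nat.cast_pos.2 hr) hC')
        (ae_lower_bound (fun j => measurable_gL2 (h₁ j)) hM hC' fun F hF => ?_)
      have hS : ∑' i : Fin r × ℤ,
          ‖fourierCoeff (fun y => gL2 U a (h₁ i.1) y * hF.toLp F y) (r * i.2)‖ ^ 2 =
          ∑' i : Fin r × ℤ, ‖fourierCoeff (fun y => gL2 U a (h₁ i.1) y * F y) (r * i.2)‖ ^ 2 := by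
        refine tsum_congr fun i => ?_
        rw [fourierCoeff_congr_ae (g := fun y => gL2 U a (h₁ i.1) y * F y)
          (hF.coeFn_toLp.mono fun y hy => by simp only [hy])]
      have hI : ∫ y, ‖F y‖ ^ 2 ∂haarAddCircle = ‖hF.toLp F‖ ^ 2 := by
        rw [norm_sq_eq_integral]
        exact integral_congr_ae (hF.coeFn_toLp.mono fun y hy => by simp only [hy])
      have h1 := hlow' (hF.toLp F) b hbK
      rw [hS, ← hβ] at h1
      set S := ∑' i : Fin r × ℤ, ‖fourierCoeff (fun y => gL2 U a (h₁ i.1) y * F y) (r * i.2)‖ ^ 2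
      have hS0 : 0 ≤ S := tsum_nonneg fun _ => by positivity
      have h2 : ‖Φ (hF.toLp F)‖ ^ 2 ≤ C * β / ‖b‖ ^ 2 * S := by
        rw [div_mul_eq_mul_div, le_div_iff₀ (by positivity)]
        linarith
      have h3 : ‖hF.toLp F‖ ≤ κ * ‖Φ (hF.toLp F)‖ := by
        have := (Φ.symm : K →L[ℂ] Lp ℂ 2 (haarAddCircle (T := (1 : ℝ)))).le_opNorm
          (Φ (hF.toLp F))
        simpa using this
      rw [hI]
      calc ‖hF.toLp F‖ ^ 2 ≤ (κ * ‖Φ (hF.toLp F)‖) ^ 2 := by gcongr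
        _ = κ ^ 2 * ‖Φ (hF.toLp F)‖ ^ 2 := by ring
        _ ≤ κ ^ 2 * (C * β / ‖b‖ ^ 2 * S) := by gcongr
        _ ≤ _ := by rw [add_mul, mul_assoc]; linarith
    -- Freezing `F` at the constant function `1`, which is nonzero: if all samples of `v` vanish,
    -- the bound forces `v = 0`.
    · refine isUnit_crossCovMatrix hVb hb hℓ h₂ fun v hv hv0 => ?_
      have h1 := hlow' (fourierLp 2 0) v hv
      simp only [hv0, norm_zero, ne_eq, OfNat.ofNat_ne_zero, not_false_eq_true, zero_pow,
        Finset.sum_const_zero, mul_zero] at h1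
      have h2 : fourierLp (T := (1 : ℝ)) 2 0 ≠ 0 := orthonormal_fourier.ne_zero 0
      have h3 : 0 < ‖Φ (fourierLp 2 0)‖ := by
        rw [norm_pos_iff]
        simpa using h2
      have h4 : ‖v‖ ^ 2 ≤ 0 := by
        by_contra h
        exact absurd (mul_pos (pow_pos h3 2) (not_le.1 h)) (not_lt.2 h1)
      simpa using h4
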